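/- Let $d\in\mathbb{N}$ and let $f:\mathbb{R}^d\to\mathbb{R}$ be twice differentiable and such that: (a) there are constants $0<\underline{C}<\overline{C}<\infty$ with $\underline{C}\le f(x)\le\overline{C}$, $\|\nabla f(x)\|_1\le\overline{C}$ and $\|\nabla^2 f(x)\|_1\le\overline{C}$ for all $x\in\mathbb{R}^d$; (b) there is a constant $K<\infty$ with $\max\{|f(x)-f(y)|,\|\nabla f(x)-\nabla f(y)\|_1,\|\nabla^2 f(x)-\nabla^2 f(y)\|_1\}\le K\|x-y\|_2$ for all $x,y\in\mathbb{R}^d$. Let $b(x,t)=\nabla_x\log\mathbb{E}[f(x+\sqrt{1-t}\,Z)]$ with $Z\sim\mathcal{N}_d(0,I)$. Let $W=(W_t)_{t\in[0,1]}$ be a standard $d$-dimensional Brownian motion and, independently of $W$, let $Z^1,\dots,Z^N$ be i.i.d. $\mathcal{N}_d(0,I)$. Put $$\hat b(x,t)=\frac{\frac1N\sum_{i=1}^N\nabla f(x+\sqrt{1-t}\,Z^i)}{\frac1N\sum_{i=1}^N f(x+\sqrt{1-t}\,Z^i)},$$ where the same $Z^1,\dots,Z^N$ are used at all times and all levels.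 For $l\in\{0,1,2,\dots\}$ let $\Delta_l=2^{-l}$ and define the Euler–Maruyama schemes, for $k\in\{0,1,\dots,\Delta_l^{-1}-1\}$, by $\widetilde X^{l,N}_0=\widetilde X^{l}_0=0$ and $$\widetilde X^{l,N}_{(k+1)\Delta_l}=\widetilde X^{l,N}_{k\Delta_l}+\hat b(\widetilde X^{l,N}_{k\Delta_l},k\Delta_l)\Delta_l+W_{(k+1)\Delta_l}-W_{k\Delta_l},$$ $$\widetilde X^{l}_{(k+1)\Delta_l}=\widetilde X^{l}_{k\Delta_l}+b(\widetilde X^{l}_{k\Delta_l},k\Delta_l)\Delta_l+W_{(k+1)\Delta_l}-W_{k\Delta_l},$$ all driven by the same Brownian motion $W$ (so each increment at level $l-1$ is the sum of the two corresponding increments at level $l$). Then there exists a constant $C<\infty$, depending only on $d$ and $f$, such that for all integers $l\ge1$ and $N\ge1$ $$\mathbb{E}\Big[\big\|(\widetilde X^{l,N}_1-\widetilde X^{l-1,N}_1)-(\widetilde X^{l}_1-\widetilde X^{l-1}_1)\big\|_2^2\Big]\le\frac{C\Delta_l}{N}.$$ -/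

import Mathlib

open MeasureTheory ProbabilityTheory

noncomputable section

namespace SchrodingerFollmer

/-- Euclidean space `ℝᵈ`; its norm is the Euclidean norm `‖·‖₂`. -/
abbrev Vec (d : ℕ) : Type := EuclideanSpace ℝ (Fin d)

/-- The `L₁`-norm of a vector. -/
def vecNorm1 {d : ℕ} (v : Vec d) : ℝ := ∑ j, |v j|

/-- The (entrywise) `L₁`-norm of a matrix. -/
def matNorm1 {d : ℕ} (A : Matrix (Fin d) (Fin d) ℝ) : ℝ := ∑ j, ∑ k, |A j k|

/-- The Hessian matrix of `f` at `x`: the `(j, k)` entry is the `k`-th partial derivative of the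
`j`-th component of the gradient. -/
def hessian {d : ℕ} (f : Vec d → ℝ) (x : Vec d) : Matrix (Fin d) (Fin d) ℝ :=
  Matrix.of fun j k => (fderiv ℝ (gradient f) x (EuclideanSpace.single k (1 : ℝ))) j

/-- The standing assumption on `f`: it is twice differentiable, bounded between two positive
constants, has bounded gradient and Hessian, and `f`, `∇f`, `∇²f` are Lipschitz. -/
structure AssumptionA1 {d : ℕ} (f : Vec d → ℝ) : Prop where
  differentiable : Differentiable ℝ f
  differentiable_gradient : Differentiable ℝ (gradient f)
  bounds : ∃ c₁ c₂ : ℝ, 0 < c₁ ∧ c₁ < c₂ ∧ ∀ x,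
    c₁ ≤ f x ∧ f x ≤ c₂ ∧ vecNorm1 (gradient f x) ≤ c₂ ∧ matNorm1 (hessian f x) ≤ c₂
  lipschitz : ∃ K : ℝ, ∀ x y,
    max |f x - f y|
      (max (vecNorm1 (gradient f x - gradient f y)) (matNorm1 (hessian f x - hessian f y)))
      ≤ K * ‖x - y‖

/-- The exact drift `b(x, t) = ∇ₓ log 𝔼[f(x + √(1 - t) Z)]`, `Z ∼ N(0, I)`. -/
def drift {d : ℕ} (f : Vec d → ℝ) (x : Vec d) (t : ℝ) : Vec d :=
  gradient (fun y : Vec d => Real.log (∫ z, f (y + √(1 - t) • z) ∂(stdGaussian (Vec d)))) x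

/-- The Monte Carlo drift `b̂(x, t)` built from the `N` sample points `z`:
the ratio of the empirical means of `∇f(x + √(1 - t) zⁱ)` and `f(x + √(1 - t) zⁱ)`. -/
def driftMC {d : ℕ} (f : Vec d → ℝ) {N : ℕ} (z : Fin N → Vec d) (x : Vec d) (t : ℝ) : Vec d :=
  ((1 / (N : ℝ)) * ∑ i, f (x + √(1 - t) • z i))⁻¹ •
    ((1 / (N : ℝ)) • ∑ i, gradient f (x + √(1 - t) • z i))

/-- The step size `Δ_l = 2^{-l}`. -/
def stepSize (l : ℕ) : ℝ := 1 / 2 ^ l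

/-- The Euler-Maruyama recursion at level `l` with drift `β`, started at `0` and driven by the
path `w`; `euler β w l k` is the state at time `k Δ_l`. -/
def euler {d : ℕ} (β : Vec d → ℝ → Vec d) (w : ℝ → Vec d) (l : ℕ) : ℕ → Vec d
  | 0 => 0
  | k + 1 => euler β w l k + stepSize l • β (euler β w l k) (k * stepSize l)
      + (w ((k + 1 : ℕ) * stepSize l) - w (k * stepSize l))

/-- The state at time `1 = 2^l Δ_l` of the Euler-Maruyama scheme at level `l`. -/
def eulerOne {d : ℕ} (β : Vec d → ℝ → Vec d) (w : ℝ → Vec d) (l : ℕ) : Vec d :=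
  euler β w l (2 ^ l)

/-- `W` is a standard `d`-dimensional Brownian motion on the time interval `[0, 1]` (the values of
`W` at other times are irrelevant). The increment `W t - W s` has law `N(0, (t - s) I)`. -/
structure IsBrownianMotion {d : ℕ} {Ω : Type*} [MeasurableSpace Ω] (W : ℝ → Ω → Vec d)
    (P : Measure Ω) : Prop where
  measurable : ∀ t ∈ Set.Icc (0 : ℝ) 1, Measurable (W t)
  start : ∀ᵐ ω ∂P, W 0 ω = 0
  indep_increments : HasIndepIncrements (fun t : unitInterval => W (t : ℝ)) P
  law_increments : ∀ s t : ℝ, 0 ≤ s → s ≤ t → t ≤ 1 →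
    HasLaw (W t - W s) ((stdGaussian (Vec d)).map fun z => √(t - s) • z) P
  continuous_paths : ∀ᵐ ω ∂P, ContinuousOn (fun t => W t ω) (Set.Icc 0 1)

/-- The random input: a Brownian motion `W` on `[0, 1]`, and independently of it
i.i.d. standard Gaussian vectors `Z¹, …, Zᴺ`. -/
structure IsRandomInput {d N : ℕ} {Ω : Type*} [MeasurableSpace Ω] (W : ℝ → Ω → Vec d)
    (Z : Fin N → Ω → Vec d) (P : Measure Ω) : Prop where
  brownian : IsBrownianMotion W P
  measurable_Z : ∀ i, Measurable (Z i)
  law_Z : ∀ i, HasLaw (Z i) (stdGaussian (Vec d)) P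
  indep_Z : iIndepFun Z P
  indep_W_Z : IndepFun (fun ω (t : unitInterval) => W (t : ℝ) ω) (fun ω i => Z i ω) P

/-- The value at time `1` of the level-`l` scheme that uses the Monte Carlo drift, the same
Gaussians `Z¹, …, Zᴺ` being used at every step (and at every level). -/
def XMC {d N : ℕ} {Ω : Type*} (f : Vec d → ℝ) (W : ℝ → Ω → Vec d) (Z : Fin N → Ω → Vec d)
    (l : ℕ) (ω : Ω) : Vec d :=
  eulerOne (driftMC f fun i => Z i ω) (fun t => W t ω) l

/-- The value at time `1` of the level-`l` scheme that uses the exact drift. -/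
def XExact {d : ℕ} {Ω : Type*} (f : Vec d → ℝ) (W : ℝ → Ω → Vec d) (l : ℕ) (ω : Ω) : Vec d :=
  eulerOne (drift f) (fun t => W t ω) l

end SchrodingerFollmer

end

/-! Fix the Brownian path `w`. The exact schemes are then deterministic, and the only randomness
left is the sample `z`. Let D_k be the coupled difference `coupledError` at coarse step k. The
driving noise cancels in it, so D_{k+1} - D_k is the fine step h times two mixed second differences
b̂(x₁,t') - b̂(x₂,t) - b(x₃,t') + b(x₄,t), where x₁, x₂ lie on the fine and coarse Monte Carlo
schemes and x₃, x₄ on the exact ones.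

By `second_diff_mixed` each of them splits in two. The four-point difference of b̂ alone is
controlled because `f` and its gradient have Lipschitz derivatives: it is at most a constant times
|x₁ - x₂ - x₃ + x₄|, which is D_k up to a small term, plus products of a Monte Carlo error (order
N^{-1/2}) with a gap between levels (order h^{1/2}). The other part is the increment of the error
field b̂ - b from (x₄,t) to (x₃,t'). The increment of an empirical-mean error is the empirical-mean
error of an increment, so its L² size is N^{-1/2}(‖x₃ - x₄‖ + √|t' - t|). This estimate needs points
that do not depend on `z`, which is why b̂ - b is evaluated only along the exact schemes.

Grönwall's inequality in L²(dz) then gives, for each path, a bound of order N^{-1/2}(√h + mean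
increment of `w`) (`DriftApprox.coupledError_L2`); the gap between exact levels is controlled
pathwise in `norm_fine_sub_coarse_le`. Since W and Z are independent, Tonelli allows integration
over W, under which the mean increment has L² norm of order √h.

What this argument needs of the drifts is collected in `DriftApprox`. It is verified in
`exists_driftApprox` by writing both drifts as `ratioDrift`, for the Gaussian and for the empirical
measure. -/

noncomputable section

namespace SchrodingerFollmer

/-! ### L² bounds and discrete Grönwall inequalities. -/

/-- `g` is measurable and its `L²(μ)` norm is at most `K`. -/
structure L2Bound {α : Type*} [MeasurableSpace α] (μ : Measure α) (g : α → ℝ) (K : ℝ) : Prop where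
  nonneg : 0 ≤ K
  aesm : AEStronglyMeasurable g μ
  eLpNorm_le : eLpNorm g 2 μ ≤ ENNReal.ofReal K

namespace L2Bound

variable {α : Type*} [MeasurableSpace α] {μ : Measure α} {g g' : α → ℝ} {K K' : ℝ}

lemma add (h : L2Bound μ g K) (h' : L2Bound μ g' K') :
    L2Bound μ (fun z => g z + g' z) (K + K') where
  nonneg := add_nonneg h.nonneg h'.nonneg
  aesm := h.aesm.add h'.aesm
  eLpNorm_le := by
    refine (eLpNorm_add_le h.aesm h'.aesm (by norm_num)).trans ?_
    rw [ENNReal.ofReal_add h.nonneg h'.nonneg]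
    exact add_le_add h.eLpNorm_le h'.eLpNorm_le

lemma const_mul (h : L2Bound μ g K) {c : ℝ} (hc : 0 ≤ c) :
    L2Bound μ (fun z => c * g z) (c * K) where
  nonneg := mul_nonneg hc h.nonneg
  aesm := h.aesm.const_mul c
  eLpNorm_le := by
    have := eLpNorm_const_smul (μ := μ) c g 2
    refine (this.le).trans ?_
    rw [ENNReal.ofReal_mul hc, Real.enorm_eq_ofReal hc]
    gcongr
    exact h.eLpNorm_le

lemma mono_fun (h : L2Bound μ g K) (hg' : AEStronglyMeasurable g' μ) (hle : ∀ z, |g' z| ≤ g z) :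
    L2Bound μ g' K where
  nonneg := h.nonneg
  aesm := hg'
  eLpNorm_le := (eLpNorm_mono_real hle).trans h.eLpNorm_le

lemma mono (h : L2Bound μ g K) (hK : K ≤ K') : L2Bound μ g K' where
  nonneg := h.nonneg.trans hK
  aesm := h.aesm
  eLpNorm_le := h.eLpNorm_le.trans (ENNReal.ofReal_le_ofReal hK)

lemma congr (h : L2Bound μ g K) (hg : ∀ z, g' z = g z) : L2Bound μ g' K := by
  have : g' = g := funext hg
  exact this ▸ h

lemma zero : L2Bound μ (fun _ : α => (0 : ℝ)) 0 where
  nonneg := le_rfl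
  aesm := aestronglyMeasurable_const
  eLpNorm_le := by simp

lemma const [IsProbabilityMeasure μ] {c : ℝ} (hc : 0 ≤ c) : L2Bound μ (fun _ => c) c where
  nonneg := hc
  aesm := aestronglyMeasurable_const
  eLpNorm_le := by
    rw [eLpNorm_const _ (by norm_num) (IsProbabilityMeasure.ne_zero μ)]
    simp [Real.enorm_eq_ofReal hc]

lemma sum {ι : Type*} (s : Finset ι) {G : ι → α → ℝ} {B : ι → ℝ}
    (h : ∀ i ∈ s, L2Bound μ (G i) (B i)) :
    L2Bound μ (fun z => ∑ i ∈ s, G i z) (∑ i ∈ s, B i) := by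
  classical
  induction s using Finset.induction_on with
  | empty => simpa using L2Bound.zero
  | insert i s hi ih =>
    simp only [Finset.sum_insert hi]
    exact (h i (by simp)).add (ih fun j hj => h j (by simp [hj]))

lemma eLpNorm_two_sq (g : α → ℝ) :
    eLpNorm g 2 μ ^ 2 = ∫⁻ z, ENNReal.ofReal (g z ^ 2) ∂μ := by
  have h1 := eLpNorm_nnreal_pow_eq_lintegral (μ := μ) (f := g) (p := 2) (by norm_num)
  have h2 : ∀ z, ENNReal.ofReal (g z ^ 2) = ‖g z‖ₑ ^ ((2 : NNReal) : ℝ) := by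
    intro z
    rw [← sq_abs, ENNReal.ofReal_pow (abs_nonneg _), Real.enorm_eq_ofReal_abs]
    simp
  simp_rw [h2]
  simpa using h1

lemma lintegral_sq_le (h : L2Bound μ g K) :
    ∫⁻ z, ENNReal.ofReal (g z ^ 2) ∂μ ≤ ENNReal.ofReal (K ^ 2) := by
  rw [← eLpNorm_two_sq, ENNReal.ofReal_pow h.nonneg, ENNReal.pow_le_pow_left_iff two_ne_zero]
  exact h.eLpNorm_le

lemma of_lintegral_sq_le (hK : 0 ≤ K) (hg : AEStronglyMeasurable g μ)
    (h : ∫⁻ z, ENNReal.ofReal (g z ^ 2) ∂μ ≤ ENNReal.ofReal (K ^ 2)) : L2Bound μ g K where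
  nonneg := hK
  aesm := hg
  eLpNorm_le := by
    rwa [← ENNReal.pow_le_pow_left_iff two_ne_zero, eLpNorm_two_sq, ← ENNReal.ofReal_pow hK]

/-- Discrete Grönwall inequality in `L²`. -/
lemma gronwall {a R : ℕ → α → ℝ} {β : ℕ → ℝ} {c : ℝ} {n : ℕ} (hc : 0 ≤ c)
    (ham : ∀ k, AEStronglyMeasurable (a k) μ) (ha : ∀ k z, 0 ≤ a k z) (h0 : ∀ z, a 0 z = 0)
    (hstep : ∀ k < n, ∀ z, a (k + 1) z ≤ (1 + c) * a k z + R k z)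
    (hR : ∀ k < n, L2Bound μ (R k) (β k)) :
    ∀ k ≤ n, L2Bound μ (a k) ((1 + c) ^ k * ∑ j ∈ Finset.range k, β j) := by
  intro k
  induction k with
  | zero => intro _; simpa using L2Bound.zero.congr h0
  | succ k ih =>
    intro hk
    have hβ := (hR k hk).nonneg
    refine (((ih (by omega)).const_mul (c := 1 + c) (by linarith)).add (hR k hk)).mono_fun
      (ham _) (fun z => ?_) |>.mono ?_
    · rw [abs_of_nonneg (ha _ z)]
      exact hstep k hk z
    · rw [Finset.sum_range_succ, mul_add, pow_succ']
      have : 1 ≤ (1 + c) * (1 + c) ^ k := by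
        rw [← pow_succ']; exact one_le_pow₀ (by linarith)
      nlinarith

end L2Bound

/-- Discrete Grönwall inequality. -/
lemma discrete_gronwall_sum {a β : ℕ → ℝ} {c : ℝ} {n : ℕ} (hc : 0 ≤ c) (h0 : a 0 = 0)
    (hβ : ∀ k, 0 ≤ β k) (hstep : ∀ k < n, a (k + 1) ≤ (1 + c) * a k + β k) :
    ∀ k ≤ n, a k ≤ (1 + c) ^ k * ∑ j ∈ Finset.range k, β j := by
  intro k
  induction k with
  | zero => simp [h0]
  | succ k ih =>
    intro hk
    have h1 := hstep k hk
    have h2 := mul_le_mul_of_nonneg_left (ih (by omega)) (by linarith : 0 ≤ 1 + c)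
    rw [Finset.sum_range_succ, mul_add, pow_succ']
    have : 1 ≤ (1 + c) * (1 + c) ^ k := by
      rw [← pow_succ']; exact one_le_pow₀ (by linarith)
    nlinarith [hβ k]

lemma one_add_pow_le_exp {c : ℝ} (hc : 0 ≤ c) (k : ℕ) : (1 + c) ^ k ≤ Real.exp (k * c) := by
  rw [Real.exp_nat_mul]
  exact pow_le_pow_left₀ (by linarith) (by linarith [Real.add_one_le_exp c]) k

/-! ### Abstract drift hypotheses and the dyadic grid. -/

/-- `bN z` is a family of random drifts, depending on a random parameter `z ∼ π`, that approximates
the drift `b` with an `L²` error of order `ε`, together with the regularity of both drifts. -/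
structure DriftApprox {d : ℕ} {α : Type*} [MeasurableSpace α] (π : Measure α)
    (b : Vec d → ℝ → Vec d) (bN : α → Vec d → ℝ → Vec d) (M : α → ℝ) (Λ ε : ℝ) : Prop where
  nonneg : 0 ≤ Λ
  eps_nonneg : 0 ≤ ε
  measurable : ∀ t, Measurable fun p : α × Vec d => bN p.1 p.2 t
  bound : ∀ x t, ‖b x t‖ ≤ Λ
  lip : ∀ x y t t', ‖b x t - b y t'‖ ≤ Λ * (‖x - y‖ + √|t - t'|)
  bound_approx : ∀ z x t, ‖bN z x t‖ ≤ Λ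
  lip_approx : ∀ z x y t, ‖bN z x t - bN z y t‖ ≤ Λ * ‖x - y‖
  second_diff : ∀ z x₁ x₂ x₃ x₄ t t',
    ‖bN z x₁ t' - bN z x₂ t - bN z x₃ t' + bN z x₄ t‖ ≤
      Λ * (‖x₁ - x₂ - x₃ + x₄‖ +
        (‖x₁ - x₃‖ + ‖x₂ - x₄‖) * (‖x₃ - x₄‖ + √|t' - t| * (Λ + M z)))
  dev : ∀ x t, L2Bound π (fun z => ‖bN z x t - b x t‖) (Λ * ε)
  dev_sub : ∀ x y t t', L2Bound π (fun z => ‖(bN z x t - b x t) - (bN z y t' - b y t')‖)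
    (Λ * ε * (‖x - y‖ + √|t - t'|))
  moment_nonneg : ∀ z, 0 ≤ M z
  moment : L2Bound π M (Λ * ε)

lemma stepSize_pos (l : ℕ) : 0 < stepSize l := by unfold stepSize; positivity

lemma two_pow_mul_stepSize (l : ℕ) : (2 : ℝ) ^ l * stepSize l = 1 := by
  unfold stepSize; field_simp

lemma stepSize_le_one (l : ℕ) : stepSize l ≤ 1 := by
  unfold stepSize
  rw [div_le_one (by positivity)]
  exact one_le_pow₀ (by norm_num)

lemma stepSize_eq_two_mul (l : ℕ) : stepSize l = 2 * stepSize (l + 1) := by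
  unfold stepSize; rw [pow_succ]; field_simp

lemma natCast_mul_stepSize_le_one {l k : ℕ} (hk : k ≤ 2 ^ l) : (k : ℝ) * stepSize l ≤ 1 := by
  rw [← two_pow_mul_stepSize l]
  have : (k : ℝ) ≤ 2 ^ l := by exact_mod_cast hk
  exact mul_le_mul_of_nonneg_right this (stepSize_pos l).le

lemma stepSize_le_sqrt (l : ℕ) : stepSize l ≤ √(stepSize l) :=
  Real.le_sqrt_of_sq_le (by nlinarith [stepSize_pos l, stepSize_le_one l])

/-- The increment of the path `w` on the `j`-th interval of the level-`l` grid. -/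
def increment {d : ℕ} (w : ℝ → Vec d) (l j : ℕ) : Vec d :=
  w ((j + 1 : ℕ) * stepSize l) - w (j * stepSize l)

/-- The average increment size of `w` over the level-`l` grid. -/
def meanIncrement {d : ℕ} (w : ℝ → Vec d) (l : ℕ) : ℝ :=
  ∑ j ∈ Finset.range (2 ^ l), stepSize l * ‖increment w l j‖

lemma meanIncrement_nonneg {d : ℕ} (w : ℝ → Vec d) (l : ℕ) : 0 ≤ meanIncrement w l :=
  Finset.sum_nonneg fun _ _ => mul_nonneg (stepSize_pos l).le (norm_nonneg _)

lemma euler_succ {d : ℕ} (β : Vec d → ℝ → Vec d) (w : ℝ → Vec d) (l k : ℕ) :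
    euler β w l (k + 1) = euler β w l k + stepSize l • β (euler β w l k) (k * stepSize l)
      + increment w l k := rfl

lemma natCast_mul_stepSize (l k : ℕ) :
    (k : ℝ) * stepSize l = ((2 * k : ℕ) : ℝ) * stepSize (l + 1) := by
  rw [stepSize_eq_two_mul]; push_cast; ring

/-- The coupling of the levels: it makes the noise cancel between two fine steps and one coarse
step. -/
lemma increment_coarse {d : ℕ} (w : ℝ → Vec d) (l k : ℕ) :
    increment w l k = increment w (l + 1) (2 * k) + increment w (l + 1) (2 * k + 1) := by
  simp only [increment]
  rw [natCast_mul_stepSize l k, natCast_mul_stepSize l (k + 1), show 2 * (k + 1) = 2 * k + 1 + 1 by ring]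
  abel

lemma sum_range_even_le {g : ℕ → ℝ} (hg : ∀ j, 0 ≤ g j) (n : ℕ) :
    ∑ k ∈ Finset.range n, g (2 * k) ≤ ∑ j ∈ Finset.range (2 * n), g j := by
  induction n with
  | zero => simp
  | succ n ih =>
    rw [Finset.sum_range_succ, show 2 * (n + 1) = 2 * n + 1 + 1 by ring, Finset.sum_range_succ,
      Finset.sum_range_succ]
    linarith [hg (2 * n + 1)]

lemma sum_even_increment_le {d : ℕ} (w : ℝ → Vec d) {m k : ℕ} (hk : k ≤ 2 ^ m) :
    ∑ j ∈ Finset.range k, stepSize (m + 1) * ‖increment w (m + 1) (2 * j)‖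
      ≤ meanIncrement w (m + 1) := by
  have h0 : ∀ j, 0 ≤ stepSize (m + 1) * ‖increment w (m + 1) j‖ :=
    fun j => mul_nonneg (stepSize_pos _).le (norm_nonneg _)
  refine (sum_range_even_le h0 k).trans ?_
  refine Finset.sum_le_sum_of_subset_of_nonneg ?_ fun j _ _ => h0 j
  intro j hj
  simp only [Finset.mem_range] at hj ⊢
  rw [pow_succ]; omega

/-! ### Error propagation along a fixed path. -/

namespace DriftApprox

variable {d : ℕ} {α : Type*} [MeasurableSpace α] {π : Measure α}
  {b : Vec d → ℝ → Vec d} {bN : α → Vec d → ℝ → Vec d} {M : α → ℝ} {Λ ε : ℝ}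

lemma measurable_euler (H : DriftApprox π b bN M Λ ε) (w : ℝ → Vec d) (l k : ℕ) :
    Measurable fun z => euler (bN z) w l k := by
  induction k with
  | zero => exact measurable_const
  | succ k ih =>
    simp only [euler_succ]
    have := (H.measurable (k * stepSize l)).comp (measurable_id.prodMk ih)
    exact (ih.add (this.const_smul (stepSize l))).add_const _

lemma euler_error_succ (β β' : Vec d → ℝ → Vec d) (w : ℝ → Vec d) (l k : ℕ) :
    euler β w l (k + 1) - euler β' w l (k + 1) = (euler β w l k - euler β' w l k)
      + stepSize l • (β (euler β w l k) (k * stepSize l)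
        - β' (euler β' w l k) (k * stepSize l)) := by
  rw [euler_succ, euler_succ, smul_sub]; abel

/-- The noise cancels, both drifts are at most `Λ`, and the total time is at most one. This crude
bound, uniform in `z`, later replaces an L² bound where the error multiplies the random factor `M
z`. -/
lemma euler_error_le (H : DriftApprox π b bN M Λ ε) (w : ℝ → Vec d) (l : ℕ) (z : α) :
    ∀ k ≤ 2 ^ l, ‖euler (bN z) w l k - euler b w l k‖ ≤ 2 * Λ := by
  have key : ∀ k, ‖euler (bN z) w l k - euler b w l k‖ ≤ 2 * Λ * (k * stepSize l) := by
    intro k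
    induction k with
    | zero => simp [euler]
    | succ k ih =>
      rw [euler_error_succ]
      refine (norm_add_le _ _).trans ?_
      rw [norm_smul, Real.norm_of_nonneg (stepSize_pos l).le]
      have h1 := (norm_sub_le (bN z (euler (bN z) w l k) (k * stepSize l))
        (b (euler b w l k) (k * stepSize l))).trans
        (add_le_add (H.bound_approx _ _ _) (H.bound _ _))
      have h2 := mul_le_mul_of_nonneg_left h1 (stepSize_pos l).le
      push_cast
      linarith
  intro k hk
  have := mul_le_mul_of_nonneg_left (natCast_mul_stepSize_le_one hk)
    (by linarith [H.nonneg] : 0 ≤ 2 * Λ)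
  linarith [key k]

/-- The Lipschitz step is taken in `bN z`, so that the remaining deviation sits at `y`, which will
be a point of the exact scheme and hence independent of `z`. -/
lemma drift_error_le (H : DriftApprox π b bN M Λ ε) (z : α) (x y : Vec d) (t : ℝ) :
    ‖bN z x t - b y t‖ ≤ Λ * ‖x - y‖ + ‖bN z y t - b y t‖ := by
  rw [← sub_add_sub_cancel (bN z x t) (bN z y t) (b y t)]
  exact (norm_add_le _ _).trans (add_le_add_left (H.lip_approx _ _ _ _) _)

lemma euler_error_L2 (H : DriftApprox π b bN M Λ ε) (w : ℝ → Vec d) (l : ℕ) :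
    ∀ k ≤ 2 ^ l, L2Bound π (fun z => ‖euler (bN z) w l k - euler b w l k‖)
      (Λ * Real.exp Λ * ε) := by
  intro k hk
  have hh := (stepSize_pos l).le
  have hc : 0 ≤ Λ * stepSize l := mul_nonneg H.nonneg hh
  refine (L2Bound.gronwall (a := fun k z => ‖euler (bN z) w l k - euler b w l k‖)
    (R := fun k z => stepSize l *
      ‖bN z (euler b w l k) (k * stepSize l) - b (euler b w l k) (k * stepSize l)‖)
    (β := fun _ => stepSize l * (Λ * ε)) hc
    (fun k => ((H.measurable_euler w l k).sub_const _).norm.aestronglyMeasurable)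
    (fun k z => norm_nonneg _) (fun z => by simp [euler]) (fun k _ z => ?_)
    (fun k _ => (H.dev _ _).const_mul hh) k hk).mono ?_
  · rw [euler_error_succ]
    refine (norm_add_le _ _).trans ?_
    rw [norm_smul, Real.norm_of_nonneg hh]
    have := mul_le_mul_of_nonneg_left
      (H.drift_error_le z (euler (bN z) w l k) (euler b w l k) (k * stepSize l)) hh
    linarith
  · rw [Finset.sum_const, Finset.card_range, nsmul_eq_mul]
    have h1 := natCast_mul_stepSize_le_one hk
    have h2 : (1 + Λ * stepSize l) ^ k ≤ Real.exp Λ := by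
      refine (one_add_pow_le_exp hc k).trans (Real.exp_le_exp.2 ?_)
      nlinarith [mul_le_mul_of_nonneg_left h1 H.nonneg]
    have h3 : 0 ≤ Λ * ε := mul_nonneg H.nonneg H.eps_nonneg
    have h4 : (k : ℝ) * (stepSize l * (Λ * ε)) ≤ Λ * ε := by
      nlinarith [mul_le_mul_of_nonneg_right h1 h3]
    calc _ ≤ Real.exp Λ * (Λ * ε) := mul_le_mul h2 h4 (by positivity) (Real.exp_pos _).le
      _ = _ := by ring

lemma euler_fine_two_step (β : Vec d → ℝ → Vec d) (w : ℝ → Vec d) (m k : ℕ) :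
    euler β w (m + 1) (2 * (k + 1)) = euler β w (m + 1) (2 * k)
      + stepSize (m + 1) •
        (β (euler β w (m + 1) (2 * k)) ((2 * k : ℕ) * stepSize (m + 1))
        + β (euler β w (m + 1) (2 * k + 1)) ((2 * k + 1 : ℕ) * stepSize (m + 1)))
      + increment w m k := by
  rw [show 2 * (k + 1) = 2 * k + 1 + 1 by ring, euler_succ _ _ _ (2 * k + 1),
    increment_coarse w m k, smul_add]
  nth_rewrite 1 [euler_succ]
  abel

/-- The coarse drift is written as two equal halves so that it subtracts termwise from
`euler_fine_two_step`. -/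
lemma euler_coarse_step (β : Vec d → ℝ → Vec d) (w : ℝ → Vec d) (m k : ℕ) :
    euler β w m (k + 1) = euler β w m k
      + stepSize (m + 1) •
        (β (euler β w m k) ((2 * k : ℕ) * stepSize (m + 1))
        + β (euler β w m k) ((2 * k : ℕ) * stepSize (m + 1)))
      + increment w m k := by
  rw [euler_succ, natCast_mul_stepSize m k, stepSize_eq_two_mul m, ← two_smul ℝ, smul_smul,
    mul_comm]

lemma abs_grid_sub (m k : ℕ) :
    |((2 * k + 1 : ℕ) : ℝ) * stepSize (m + 1) - ((2 * k : ℕ) : ℝ) * stepSize (m + 1)|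
      = stepSize (m + 1) := by
  rw [← sub_mul]; push_cast
  rw [add_sub_cancel_left, one_mul, abs_of_pos (stepSize_pos _)]

/-- At an odd node the fine scheme is one step ahead, and its Brownian increment has no coarse
counterpart. This is where the increments of `w` enter the estimates. -/
lemma norm_odd_sub_coarse_le (H : DriftApprox π b bN M Λ ε) (w : ℝ → Vec d) (m k : ℕ) :
    ‖euler b w (m + 1) (2 * k + 1) - euler b w m k‖ ≤
      ‖euler b w (m + 1) (2 * k) - euler b w m k‖ + stepSize (m + 1) * Λ
        + ‖increment w (m + 1) (2 * k)‖ := by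
  rw [euler_succ, show ∀ x y z u : Vec d, x + y + z - u = (x - u) + y + z by intros; abel]
  refine (norm_add₃_le).trans ?_
  rw [norm_smul, Real.norm_of_nonneg (stepSize_pos _).le]
  gcongr
  · exact (stepSize_pos _).le
  · exact H.bound _ _

/-- The strong error between two consecutive levels of the exact scheme, for a fixed path. -/
lemma norm_fine_sub_coarse_le (H : DriftApprox π b bN M Λ ε) (w : ℝ → Vec d) (m : ℕ) :
    ∀ k ≤ 2 ^ m, ‖euler b w (m + 1) (2 * k) - euler b w m k‖ ≤
      Real.exp Λ * Λ * (Λ + 1) * (√(stepSize (m + 1)) + meanIncrement w (m + 1)) := by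
  intro k hk
  set h := stepSize (m + 1) with hh_def
  have hh : 0 ≤ h := (stepSize_pos _).le
  have hΛ := H.nonneg
  have hc : 0 ≤ 2 * Λ * h := by positivity
  have h1 : (2 ^ m : ℝ) * (2 * h) = 1 := by
    rw [hh_def, ← stepSize_eq_two_mul, two_pow_mul_stepSize]
  have hk' : (k : ℝ) ≤ 2 ^ m := by exact_mod_cast hk
  have hk1 : (k : ℝ) * (2 * h) ≤ 1 := by
    rw [← h1]; gcongr
  have hV := meanIncrement_nonneg w (m + 1)
  -- Each half step contributes `Λ * h` to the growth rate, and `2 ^ m * (2 * h) = 1` turns the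
  -- product of the growth factors into `exp Λ`.
  refine (discrete_gronwall_sum (a := fun k => ‖euler b w (m + 1) (2 * k) - euler b w m k‖)
    (β := fun k => Λ * (h * ((Λ + 1) * √h) + h * ‖increment w (m + 1) (2 * k)‖)) (n := 2 ^ m)
    hc (by simp [euler]) (fun k => by positivity) (fun k _ => ?_) k hk).trans ?_
  · rw [euler_fine_two_step, euler_coarse_step b w m k, ← hh_def,
      show ∀ x y z u v : Vec d, x + h • y + z - (u + h • v + z) = (x - u) + h • (y - v) by
        intros; rw [smul_sub]; abel]
    refine (norm_add_le _ _).trans ?_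
    rw [norm_smul, Real.norm_of_nonneg hh, add_sub_add_comm]
    have e1 := H.lip (euler b w (m + 1) (2 * k)) (euler b w m k) ((2 * k : ℕ) * h)
      ((2 * k : ℕ) * h)
    have e2 := H.lip (euler b w (m + 1) (2 * k + 1)) (euler b w m k) ((2 * k + 1 : ℕ) * h)
      ((2 * k : ℕ) * h)
    rw [sub_self, abs_zero, Real.sqrt_zero, add_zero] at e1
    rw [abs_grid_sub] at e2
    have e3 := H.norm_odd_sub_coarse_le w m k
    have e4 := stepSize_le_sqrt (m + 1)
    have e5 := norm_add_le (b (euler b w (m + 1) (2 * k)) ((2 * k : ℕ) * h)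
      - b (euler b w m k) ((2 * k : ℕ) * h))
      (b (euler b w (m + 1) (2 * k + 1)) ((2 * k + 1 : ℕ) * h)
      - b (euler b w m k) ((2 * k : ℕ) * h))
    rw [← hh_def] at e2 e3 e4
    set r := ‖euler b w (m + 1) (2 * k) - euler b w m k‖
    set I := ‖increment w (m + 1) (2 * k)‖
    have e6 : ‖euler b w (m + 1) (2 * k + 1) - euler b w m k‖ + √h ≤
        r + (Λ + 1) * √h + I := by
      nlinarith [mul_le_mul_of_nonneg_right e4 hΛ]
    have e7 := mul_le_mul_of_nonneg_left e6 hΛ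
    have e8 := mul_le_mul_of_nonneg_left (e5.trans (add_le_add e1 (e2.trans e7))) hh
    refine (add_le_add_right e8 r).trans (le_of_eq ?_)
    ring
  · have g1 : (1 + 2 * Λ * h) ^ k ≤ Real.exp Λ := by
      refine (one_add_pow_le_exp hc k).trans (Real.exp_le_exp.2 ?_)
      nlinarith [mul_le_mul_of_nonneg_left hk1 hΛ]
    have g2 := sum_even_increment_le w hk
    rw [← hh_def] at g2
    have g3 : ∑ j ∈ Finset.range k, Λ * (h * ((Λ + 1) * √h) + h * ‖increment w (m + 1) (2 * j)‖)
        ≤ Λ * ((Λ + 1) * (√h + meanIncrement w (m + 1))) := by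
      rw [← Finset.mul_sum, Finset.sum_add_distrib, Finset.sum_const, Finset.card_range,
        nsmul_eq_mul]
      refine mul_le_mul_of_nonneg_left ?_ hΛ
      have g4 : (k : ℝ) * h ≤ 1 := by nlinarith [mul_nonneg (Nat.cast_nonneg (α := ℝ) k) hh]
      have g5 : 0 ≤ (Λ + 1) * √h := by positivity
      nlinarith [mul_le_mul_of_nonneg_right g4 g5, mul_nonneg hΛ hV]
    refine (mul_le_mul g1 g3 (Finset.sum_nonneg fun j _ => by positivity)
      (Real.exp_pos _).le).trans (le_of_eq ?_)
    ring

/-- The coupled difference of the approximate and the exact two-level corrections. -/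
def coupledError (b : Vec d → ℝ → Vec d) (bN : α → Vec d → ℝ → Vec d) (w : ℝ → Vec d) (m k : ℕ)
    (z : α) : Vec d :=
  (euler (bN z) w (m + 1) (2 * k) - euler (bN z) w m k)
    - (euler b w (m + 1) (2 * k) - euler b w m k)

omit [MeasurableSpace α] in
-- In the second bracket the fine schemes use the odd time and the coarse ones still the preceding
-- even time, hence the time mismatch allowed in `second_diff`.
lemma coupledError_succ (w : ℝ → Vec d) (m k : ℕ) (z : α) :
    coupledError b bN w m (k + 1) z = coupledError b bN w m k z
      + stepSize (m + 1) •
        ((bN z (euler (bN z) w (m + 1) (2 * k)) ((2 * k : ℕ) * stepSize (m + 1))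
          - bN z (euler (bN z) w m k) ((2 * k : ℕ) * stepSize (m + 1))
          - b (euler b w (m + 1) (2 * k)) ((2 * k : ℕ) * stepSize (m + 1))
          + b (euler b w m k) ((2 * k : ℕ) * stepSize (m + 1)))
        + (bN z (euler (bN z) w (m + 1) (2 * k + 1)) ((2 * k + 1 : ℕ) * stepSize (m + 1))
          - bN z (euler (bN z) w m k) ((2 * k : ℕ) * stepSize (m + 1))
          - b (euler b w (m + 1) (2 * k + 1)) ((2 * k + 1 : ℕ) * stepSize (m + 1))
          + b (euler b w m k) ((2 * k : ℕ) * stepSize (m + 1)))) := by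
  simp only [coupledError, euler_fine_two_step, euler_coarse_step]
  simp only [smul_add, smul_sub]
  abel

/-- The second difference of drifts, with a mismatch between the approximate and exact drift. -/
lemma second_diff_mixed (H : DriftApprox π b bN M Λ ε) (z : α) (x₁ x₂ x₃ x₄ : Vec d) (t t' : ℝ) :
    ‖bN z x₁ t' - bN z x₂ t - b x₃ t' + b x₄ t‖ ≤
      Λ * (‖x₁ - x₂ - x₃ + x₄‖ +
        (‖x₁ - x₃‖ + ‖x₂ - x₄‖) * (‖x₃ - x₄‖ + √|t' - t| * (Λ + M z)))
      + ‖(bN z x₃ t' - b x₃ t') - (bN z x₄ t - b x₄ t)‖ := by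
  rw [show bN z x₁ t' - bN z x₂ t - b x₃ t' + b x₄ t
    = (bN z x₁ t' - bN z x₂ t - bN z x₃ t' + bN z x₄ t)
      + ((bN z x₃ t' - b x₃ t') - (bN z x₄ t - b x₄ t)) by abel]
  exact (norm_add_le _ _).trans (add_le_add_left (H.second_diff _ _ _ _ _ _ _) _)

/-- The constant of the two-level estimate. -/
def coupledConst (Λ : ℝ) : ℝ :=
  Real.exp Λ * ((2 * Λ * (Λ * Real.exp Λ) + Λ) * (Real.exp Λ * Λ * (Λ + 1))
    + Λ * (Λ * (Λ * Real.exp Λ) + Λ)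
    + 2 * Λ * (Λ * Real.exp Λ) * (Real.exp Λ * Λ * (Λ + 1) + Λ + Λ) + 4 * Λ ^ 3
    + Λ * (Real.exp Λ * Λ * (Λ + 1) + Λ + 1) + (2 * Λ * (Λ * Real.exp Λ) + Λ))

/-- The source term of the recursion for the coupled error. -/
def coupledSource (b : Vec d → ℝ → Vec d) (bN : α → Vec d → ℝ → Vec d) (M : α → ℝ) (Λ : ℝ)
    (w : ℝ → Vec d) (m k : ℕ) (z : α) : ℝ :=
  Λ * ‖euler b w (m + 1) (2 * k) - euler b w m k‖ *
      (‖euler (bN z) w (m + 1) (2 * k) - euler b w (m + 1) (2 * k)‖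
        + ‖euler (bN z) w m k - euler b w m k‖)
    + ‖(bN z (euler b w (m + 1) (2 * k)) ((2 * k : ℕ) * stepSize (m + 1))
          - b (euler b w (m + 1) (2 * k)) ((2 * k : ℕ) * stepSize (m + 1)))
        - (bN z (euler b w m k) ((2 * k : ℕ) * stepSize (m + 1))
          - b (euler b w m k) ((2 * k : ℕ) * stepSize (m + 1)))‖
    + Λ * stepSize (m + 1) *
      (Λ * ‖euler (bN z) w (m + 1) (2 * k) - euler b w (m + 1) (2 * k)‖
        + ‖bN z (euler b w (m + 1) (2 * k)) ((2 * k : ℕ) * stepSize (m + 1))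
          - b (euler b w (m + 1) (2 * k)) ((2 * k : ℕ) * stepSize (m + 1))‖)
    + Λ * (‖euler b w (m + 1) (2 * k + 1) - euler b w m k‖ + √(stepSize (m + 1)) * Λ) *
      (‖euler (bN z) w (m + 1) (2 * k + 1) - euler b w (m + 1) (2 * k + 1)‖
        + ‖euler (bN z) w m k - euler b w m k‖)
    + 4 * Λ ^ 2 * √(stepSize (m + 1)) * M z
    + ‖(bN z (euler b w (m + 1) (2 * k + 1)) ((2 * k + 1 : ℕ) * stepSize (m + 1))
          - b (euler b w (m + 1) (2 * k + 1)) ((2 * k + 1 : ℕ) * stepSize (m + 1)))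
        - (bN z (euler b w m k) ((2 * k : ℕ) * stepSize (m + 1))
          - b (euler b w m k) ((2 * k : ℕ) * stepSize (m + 1)))‖

lemma coupledError_succ_le (H : DriftApprox π b bN M Λ ε) (w : ℝ → Vec d) {m k : ℕ}
    (hk : k < 2 ^ m) (z : α) :
    ‖coupledError b bN w m (k + 1) z‖ ≤
      (1 + 2 * Λ * stepSize (m + 1)) * ‖coupledError b bN w m k z‖
        + stepSize (m + 1) * coupledSource b bN M Λ w m k z := by
  have hΛ := H.nonneg
  have hh : 0 ≤ stepSize (m + 1) := (stepSize_pos _).le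
  have hodd : 2 * k + 1 ≤ 2 ^ (m + 1) := by rw [pow_succ]; omega
  rw [coupledError_succ]
  refine (norm_add_le _ _).trans ?_
  rw [norm_smul, Real.norm_of_nonneg hh]
  have e1 := H.second_diff_mixed z (euler (bN z) w (m + 1) (2 * k)) (euler (bN z) w m k)
    (euler b w (m + 1) (2 * k)) (euler b w m k) ((2 * k : ℕ) * stepSize (m + 1))
    ((2 * k : ℕ) * stepSize (m + 1))
  have e2 := H.second_diff_mixed z (euler (bN z) w (m + 1) (2 * k + 1)) (euler (bN z) w m k)
    (euler b w (m + 1) (2 * k + 1)) (euler b w m k) ((2 * k : ℕ) * stepSize (m + 1))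
    ((2 * k + 1 : ℕ) * stepSize (m + 1))
  rw [abs_grid_sub] at e2
  rw [sub_self, abs_zero, Real.sqrt_zero, zero_mul, add_zero] at e1
  have u1 : euler (bN z) w (m + 1) (2 * k) - euler (bN z) w m k - euler b w (m + 1) (2 * k)
      + euler b w m k = coupledError b bN w m k z := by
    simp only [coupledError]; abel
  -- Both fine schemes have made one more step with the same increment while the coarse ones have
  -- not moved, so only one drift error is added.
  have u2 : euler (bN z) w (m + 1) (2 * k + 1) - euler (bN z) w m k
      - euler b w (m + 1) (2 * k + 1) + euler b w m k = coupledError b bN w m k z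
      + stepSize (m + 1) • (bN z (euler (bN z) w (m + 1) (2 * k)) ((2 * k : ℕ) * stepSize (m + 1))
        - b (euler b w (m + 1) (2 * k)) ((2 * k : ℕ) * stepSize (m + 1))) := by
    simp only [coupledError, euler_succ, smul_sub]; abel
  have u3 : ‖euler (bN z) w (m + 1) (2 * k + 1) - euler (bN z) w m k
      - euler b w (m + 1) (2 * k + 1) + euler b w m k‖ ≤ ‖coupledError b bN w m k z‖
      + stepSize (m + 1) * (Λ * ‖euler (bN z) w (m + 1) (2 * k) - euler b w (m + 1) (2 * k)‖
        + ‖bN z (euler b w (m + 1) (2 * k)) ((2 * k : ℕ) * stepSize (m + 1))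
          - b (euler b w (m + 1) (2 * k)) ((2 * k : ℕ) * stepSize (m + 1))‖) := by
    rw [u2]
    refine (norm_add_le _ _).trans ?_
    rw [norm_smul, Real.norm_of_nonneg hh]
    gcongr
    exact H.drift_error_le _ _ _ _
  rw [u1] at e1
  have b1 := H.euler_error_le w (m + 1) z (2 * k + 1) hodd
  have b2 := H.euler_error_le w m z k hk.le
  -- Trajectory error and `M z` are both random, and a product of two L² functions need not be in
  -- L². The uniform bound `2 * Λ` on each trajectory error leaves a term linear in `M z`.
  have b3 : (‖euler (bN z) w (m + 1) (2 * k + 1) - euler b w (m + 1) (2 * k + 1)‖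
        + ‖euler (bN z) w m k - euler b w m k‖) * (√(stepSize (m + 1)) * M z)
      ≤ 4 * Λ * (√(stepSize (m + 1)) * M z) :=
    mul_le_mul_of_nonneg_right (by linarith)
      (mul_nonneg (Real.sqrt_nonneg _) (H.moment_nonneg z))
  have e3 := (norm_add_le _ _).trans (add_le_add e1 e2)
  have e4 := mul_le_mul_of_nonneg_left e3 hh
  refine (add_le_add_right e4 _).trans ?_
  have u4 := mul_le_mul_of_nonneg_left u3 hΛ
  have b4 := mul_le_mul_of_nonneg_left b3 hΛ
  have e5 := mul_le_mul_of_nonneg_left (add_le_add u4 b4) hh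
  simp only [coupledSource]
  linarith

/-- Every term of the source is a factor depending only on `w` times a function of `z` with L² norm
of order `ε`, so the triangle inequality suffices. -/
lemma coupledSource_L2 (H : DriftApprox π b bN M Λ ε) (w : ℝ → Vec d) {m k : ℕ}
    (hk : k < 2 ^ m) :
    L2Bound π (coupledSource b bN M Λ w m k)
      (ε * (((2 * Λ * (Λ * Real.exp Λ) + Λ) * (Real.exp Λ * Λ * (Λ + 1))
        + Λ * (Λ * (Λ * Real.exp Λ) + Λ)
        + 2 * Λ * (Λ * Real.exp Λ) * (Real.exp Λ * Λ * (Λ + 1) + Λ + Λ) + 4 * Λ ^ 3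
        + Λ * (Real.exp Λ * Λ * (Λ + 1) + Λ + 1))
          * (√(stepSize (m + 1)) + meanIncrement w (m + 1))
        + (2 * Λ * (Λ * Real.exp Λ) + Λ) * ‖increment w (m + 1) (2 * k)‖)) := by
  have hΛ := H.nonneg
  have hε := H.eps_nonneg
  have hh : 0 ≤ stepSize (m + 1) := (stepSize_pos _).le
  have hs := Real.sqrt_nonneg (stepSize (m + 1))
  have hodd : 2 * k + 1 ≤ 2 ^ (m + 1) := by rw [pow_succ]; omega
  have E1 := H.euler_error_L2 w (m + 1) (2 * k) (by omega)
  have E2 := H.euler_error_L2 w (m + 1) (2 * k + 1) hodd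
  have E3 := H.euler_error_L2 w m k hk.le
  have d1 := H.dev_sub (euler b w (m + 1) (2 * k)) (euler b w m k)
    ((2 * k : ℕ) * stepSize (m + 1)) ((2 * k : ℕ) * stepSize (m + 1))
  have d2 := H.dev_sub (euler b w (m + 1) (2 * k + 1)) (euler b w m k)
    ((2 * k + 1 : ℕ) * stepSize (m + 1)) ((2 * k : ℕ) * stepSize (m + 1))
  rw [abs_grid_sub] at d2
  rw [sub_self, abs_zero, Real.sqrt_zero, add_zero] at d1
  have d3 := H.dev (euler b w (m + 1) (2 * k)) ((2 * k : ℕ) * stepSize (m + 1))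
  have hr := H.norm_fine_sub_coarse_le w m k hk.le
  have hr' := H.norm_odd_sub_coarse_le w m k
  have hsq := stepSize_le_sqrt (m + 1)
  have hV := meanIncrement_nonneg w (m + 1)
  have total := ((((((E1.add E3).const_mul (c := Λ *
      ‖euler b w (m + 1) (2 * k) - euler b w m k‖) (by positivity)).add d1).add
    (((E1.const_mul hΛ).add d3).const_mul (mul_nonneg hΛ hh))).add
    ((E2.add E3).const_mul (c := Λ * (‖euler b w (m + 1) (2 * k + 1) - euler b w m k‖
      + √(stepSize (m + 1)) * Λ)) (by positivity))).add
    (H.moment.const_mul (c := 4 * Λ ^ 2 * √(stepSize (m + 1))) (by positivity))).add d2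
  refine (total.congr fun z => rfl).mono ?_
  have hΛe : 0 ≤ Λ * Real.exp Λ := by positivity
  generalize Λ * Real.exp Λ = c₁ at *
  have hc₂ : 0 ≤ Real.exp Λ * Λ * (Λ + 1) := by positivity
  generalize Real.exp Λ * Λ * (Λ + 1) = c₂ at *
  generalize ‖euler b w (m + 1) (2 * k) - euler b w m k‖ = r at *
  generalize ‖euler b w (m + 1) (2 * k + 1) - euler b w m k‖ = r' at *
  generalize ‖increment w (m + 1) (2 * k)‖ = I at *
  generalize √(stepSize (m + 1)) = s at *
  generalize stepSize (m + 1) = h at *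
  generalize meanIncrement w (m + 1) = V at *
  have k1 : h ≤ s + V := by linarith
  have k2 : s ≤ s + V := by linarith
  have k3 : r' ≤ (c₂ + Λ) * (s + V) + I := by
    nlinarith [mul_le_mul_of_nonneg_right k1 hΛ]
  -- The accumulated bound is linear in `r`, `h`, `r'` and `s`; each is now replaced by its bound in
  -- terms of `s + V` and `I`.
  have l1 := mul_le_mul_of_nonneg_left hr (by positivity : 0 ≤ ε * (2 * Λ * c₁ + Λ))
  have l2 := mul_le_mul_of_nonneg_left k1 (by positivity : 0 ≤ ε * (Λ * (Λ * c₁ + Λ)))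
  have l3 := mul_le_mul_of_nonneg_left k3 (by positivity : 0 ≤ ε * (2 * Λ * c₁ + Λ))
  have l4 := mul_le_mul_of_nonneg_left k2
    (by positivity : 0 ≤ ε * (2 * Λ * c₁ * Λ + 4 * Λ ^ 3 + Λ))
  linarith

/-- For a fixed path `w`, the coupled two-level error is of order `ε` times the strong error. -/
theorem coupledError_L2 (H : DriftApprox π b bN M Λ ε) (w : ℝ → Vec d) (m : ℕ) :
    L2Bound π (fun z => ‖coupledError b bN w m (2 ^ m) z‖)
      (coupledConst Λ * ε * (√(stepSize (m + 1)) + meanIncrement w (m + 1))) := by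
  have hΛ := H.nonneg
  have hε := H.eps_nonneg
  have hh : 0 ≤ stepSize (m + 1) := (stepSize_pos _).le
  have hc : 0 ≤ 2 * Λ * stepSize (m + 1) := by positivity
  have h1 : (2 ^ m : ℝ) * (2 * stepSize (m + 1)) = 1 := by
    rw [← stepSize_eq_two_mul, two_pow_mul_stepSize]
  refine (L2Bound.gronwall (a := fun k z => ‖coupledError b bN w m k z‖)
    (R := fun k z => stepSize (m + 1) * coupledSource b bN M Λ w m k z) hc
    (fun k => ?_) (fun k z => norm_nonneg _) (fun z => by simp [coupledError, euler])
    (fun k hk z => H.coupledError_succ_le w hk z)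
    (fun k hk => (H.coupledSource_L2 w hk).const_mul hh) (2 ^ m) le_rfl).mono ?_
  · exact ((((H.measurable_euler w (m + 1) (2 * k)).sub
      (H.measurable_euler w m k)).sub_const _).norm).aestronglyMeasurable
  · have g1 : (1 + 2 * Λ * stepSize (m + 1)) ^ (2 ^ m) ≤ Real.exp Λ := by
      refine (one_add_pow_le_exp hc _).trans (Real.exp_le_exp.2 ?_)
      push_cast
      nlinarith [mul_le_mul_of_nonneg_left h1.le hΛ]
    have g2 := sum_even_increment_le w (le_refl (2 ^ m))
    have hV := meanIncrement_nonneg w (m + 1)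
    have hs := Real.sqrt_nonneg (stepSize (m + 1))
    have hA : 0 ≤ (2 * Λ * (Λ * Real.exp Λ) + Λ) * (Real.exp Λ * Λ * (Λ + 1))
        + Λ * (Λ * (Λ * Real.exp Λ) + Λ)
        + 2 * Λ * (Λ * Real.exp Λ) * (Real.exp Λ * Λ * (Λ + 1) + Λ + Λ) + 4 * Λ ^ 3
        + Λ * (Real.exp Λ * Λ * (Λ + 1) + Λ + 1) := by positivity
    have hB : 0 ≤ 2 * Λ * (Λ * Real.exp Λ) + Λ := by positivity
    unfold coupledConst
    generalize (2 * Λ * (Λ * Real.exp Λ) + Λ) * (Real.exp Λ * Λ * (Λ + 1))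
        + Λ * (Λ * (Λ * Real.exp Λ) + Λ)
        + 2 * Λ * (Λ * Real.exp Λ) * (Real.exp Λ * Λ * (Λ + 1) + Λ + Λ) + 4 * Λ ^ 3
        + Λ * (Real.exp Λ * Λ * (Λ + 1) + Λ + 1) = A at *
    generalize 2 * Λ * (Λ * Real.exp Λ) + Λ = B at *
    -- The `A` part is constant in `j` and sums by `2 ^ m * stepSize (m + 1) ≤ 1`; the `B` part sums
    -- to at most the mean increment.
    have hsum : ∑ j ∈ Finset.range (2 ^ m), stepSize (m + 1) *
        (ε * (A * (√(stepSize (m + 1)) + meanIncrement w (m + 1))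
          + B * ‖increment w (m + 1) (2 * j)‖))
        ≤ ε * ((A + B) * (√(stepSize (m + 1)) + meanIncrement w (m + 1))) := by
      have : ∀ j, stepSize (m + 1) *
        (ε * (A * (√(stepSize (m + 1)) + meanIncrement w (m + 1))
          + B * ‖increment w (m + 1) (2 * j)‖)) =
          ε * A * stepSize (m + 1) * (√(stepSize (m + 1)) + meanIncrement w (m + 1))
          + ε * B * (stepSize (m + 1) * ‖increment w (m + 1) (2 * j)‖) := fun j => by ring
      simp_rw [this]
      rw [Finset.sum_add_distrib, Finset.sum_const, Finset.card_range, nsmul_eq_mul,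
        ← Finset.mul_sum]
      push_cast
      have q1 := mul_le_mul_of_nonneg_left g2 (by positivity : 0 ≤ ε * B)
      have q2 : (2 ^ m : ℝ) * stepSize (m + 1) ≤ 1 := by linarith
      have q3 := mul_le_mul_of_nonneg_right q2
        (by positivity : 0 ≤ ε * A * (√(stepSize (m + 1)) + meanIncrement w (m + 1)))
      have q4 : 0 ≤ ε * B * √(stepSize (m + 1)) := by positivity
      linarith
    refine (mul_le_mul g1 hsum (Finset.sum_nonneg fun j _ => by positivity)
      (Real.exp_pos _).le).trans (le_of_eq ?_)
    ring

end DriftApprox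

/-! ### Second-order regularity of `f` and its gradient. -/

/-- `g` is continuous, bounded, Lipschitz, and satisfies a second-order (four-point) Lipschitz
bound, all with the constant `L`. -/
structure FourPoint {d : ℕ} {V : Type*} [NormedAddCommGroup V] (g : Vec d → V) (L : ℝ) : Prop where
  continuous : Continuous g
  bound : ∀ x, ‖g x‖ ≤ L
  lip : ∀ x y, ‖g x - g y‖ ≤ L * ‖x - y‖
  four_point : ∀ x₁ x₂ x₃ x₄, ‖g x₁ - g x₂ - g x₃ + g x₄‖ ≤
    L * (‖x₁ - x₂ - x₃ + x₄‖ + (‖x₁ - x₃‖ + ‖x₂ - x₄‖) * ‖x₃ - x₄‖)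

section FourPoint

variable {d : ℕ} {V : Type*} [NormedAddCommGroup V] {g : Vec d → V} {L : ℝ}

lemma FourPoint.nonneg (hg : FourPoint g L) : 0 ≤ L := (norm_nonneg _).trans (hg.bound 0)

/-- For the four-point bound, apply the mean value inequality to the difference of `g` along the
segments from `x₂` to `x₁` and from `x₄` to `x₃`. -/
lemma FourPoint.of_fderiv [NormedSpace ℝ V] (hd : Differentiable ℝ g) (hb : ∀ x, ‖g x‖ ≤ L)
    (hb' : ∀ x, ‖fderiv ℝ g x‖ ≤ L)
    (hl : ∀ x y, ‖fderiv ℝ g x - fderiv ℝ g y‖ ≤ L * ‖x - y‖) : FourPoint g L where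
  continuous := hd.continuous
  bound := hb
  lip x y := Convex.norm_image_sub_le_of_norm_fderiv_le (𝕜 := ℝ) (fun z _ => hd z)
    (fun z _ => hb' z) convex_univ (Set.mem_univ y) (Set.mem_univ x)
  four_point x₁ x₂ x₃ x₄ := by
    have hL : 0 ≤ L := (norm_nonneg _).trans (hb 0)
    have hline : ∀ (p q : Vec d) (t : ℝ), HasDerivAt (fun t : ℝ => g (q + t • (p - q)))
        (fderiv ℝ g (q + t • (p - q)) (p - q)) t := by
      intro p q t
      have h1 : HasDerivAt (fun t : ℝ => q + t • (p - q)) (p - q) t := by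
        simpa using ((hasDerivAt_id t).smul_const (p - q)).const_add q
      exact (hd _).hasFDerivAt.comp_hasDerivAt t h1
    have key := norm_image_sub_le_of_norm_deriv_le_segment_01'
      (f := fun t : ℝ => g (x₂ + t • (x₁ - x₂)) - g (x₄ + t • (x₃ - x₄)))
      (f' := fun t => fderiv ℝ g (x₂ + t • (x₁ - x₂)) (x₁ - x₂)
        - fderiv ℝ g (x₄ + t • (x₃ - x₄)) (x₃ - x₄))
      (C := L * (‖x₁ - x₂ - x₃ + x₄‖ + (‖x₁ - x₃‖ + ‖x₂ - x₄‖) * ‖x₃ - x₄‖))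
      (fun t _ => ((hline x₁ x₂ t).sub (hline x₃ x₄ t)).hasDerivWithinAt) ?_
    · simp only [one_smul, zero_smul, add_zero, add_sub_cancel] at key
      rwa [show g x₁ - g x₃ - (g x₂ - g x₄) = g x₁ - g x₂ - g x₃ + g x₄ by abel] at key
    · intro t ht
      -- The difference of directions meets the bound on the derivative, and the difference of base
      -- points its Lipschitz bound.
      have e : fderiv ℝ g (x₂ + t • (x₁ - x₂)) (x₁ - x₂)
          - fderiv ℝ g (x₄ + t • (x₃ - x₄)) (x₃ - x₄)
          = fderiv ℝ g (x₂ + t • (x₁ - x₂)) (x₁ - x₂ - x₃ + x₄)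
          + (fderiv ℝ g (x₂ + t • (x₁ - x₂)) - fderiv ℝ g (x₄ + t • (x₃ - x₄))) (x₃ - x₄) := by
        simp only [map_sub, map_add, sub_apply]
        abel
      have e' : x₂ + t • (x₁ - x₂) - (x₄ + t • (x₃ - x₄))
          = (1 - t) • (x₂ - x₄) + t • (x₁ - x₃) := by
        simp only [smul_sub, sub_smul, one_smul]; abel
      have h1 : ‖x₂ + t • (x₁ - x₂) - (x₄ + t • (x₃ - x₄))‖ ≤ ‖x₁ - x₃‖ + ‖x₂ - x₄‖ := by
        rw [e']
        refine (norm_add_le _ _).trans ?_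
        rw [norm_smul, norm_smul, Real.norm_of_nonneg ht.1,
          Real.norm_of_nonneg (by linarith [ht.2] : (0 : ℝ) ≤ 1 - t)]
        nlinarith [norm_nonneg (x₁ - x₃), norm_nonneg (x₂ - x₄), ht.1, ht.2]
      rw [e, mul_add, ← mul_assoc]
      refine (norm_add_le _ _).trans (add_le_add ?_ ?_)
      · exact ContinuousLinearMap.le_of_opNorm_le _ (hb' _) _
      · refine ContinuousLinearMap.le_of_opNorm_le _ ((hl _ _).trans ?_) _
        gcongr

end FourPoint

lemma norm_le_vecNorm1 {d : ℕ} (v : Vec d) : ‖v‖ ≤ vecNorm1 v := by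
  have hv : v = ∑ j, EuclideanSpace.single j (v j) := by
    ext i
    simp [Finset.sum_apply]
  conv_lhs => rw [hv]
  refine (norm_sum_le _ _).trans (le_of_eq ?_)
  simp [vecNorm1]

lemma opNorm_le_sum_abs {d : ℕ} (T : Vec d →L[ℝ] Vec d) :
    ‖T‖ ≤ ∑ j, ∑ k, |T (EuclideanSpace.single k (1 : ℝ)) j| := by
  refine T.opNorm_le_bound (by positivity) fun v => ?_
  have hv : v = ∑ k, v k • EuclideanSpace.single k (1 : ℝ) := by
    ext i
    simp [Finset.sum_apply, Pi.single_apply]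
  refine (norm_le_vecNorm1 _).trans ?_
  rw [vecNorm1, Finset.sum_mul]
  refine Finset.sum_le_sum fun j _ => ?_
  have : T v j = ∑ k, v k * T (EuclideanSpace.single k (1 : ℝ)) j := by
    conv_lhs => rw [hv]
    simp [map_sum, Finset.sum_apply]
  rw [this, Finset.sum_mul]
  refine (Finset.abs_sum_le_sum_abs _ _).trans (Finset.sum_le_sum fun k _ => ?_)
  rw [abs_mul, mul_comm]
  gcongr
  exact PiLp.norm_apply_le v k

lemma AssumptionA1.exists_fourPoint {d : ℕ} {f : Vec d → ℝ} (hf : AssumptionA1 f) :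
    ∃ c L : ℝ, 0 < c ∧ (∀ x, c ≤ f x) ∧ FourPoint f L ∧ FourPoint (gradient f) L := by
  obtain ⟨c, c₂, hc, -, hb⟩ := hf.bounds
  obtain ⟨K, hK⟩ := hf.lipschitz
  -- The sign of `K` is not assumed, hence the absolute value.
  set L := max c₂ |K|
  have hfd : ∀ x, fderiv ℝ f x = InnerProductSpace.toDual ℝ (Vec d) (gradient f x) := fun x =>
    (hf.differentiable x).hasGradientAt.hasFDerivAt.fderiv
  have hKL : ∀ x y : Vec d, K * ‖x - y‖ ≤ L * ‖x - y‖ := fun x y => by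
    gcongr
    exact (le_abs_self K).trans (le_max_right _ _)
  refine ⟨c, L, hc, fun x => (hb x).1, ?_, ?_⟩
  · refine FourPoint.of_fderiv hf.differentiable (fun x => ?_) (fun x => ?_) (fun x y => ?_)
    · rw [Real.norm_of_nonneg (hc.le.trans (hb x).1)]
      exact (hb x).2.1.trans (le_max_left _ _)
    · rw [hfd, LinearIsometryEquiv.norm_map]
      exact (norm_le_vecNorm1 _).trans ((hb x).2.2.1.trans (le_max_left _ _))
    · rw [hfd, hfd, ← map_sub, LinearIsometryEquiv.norm_map]
      refine (norm_le_vecNorm1 _).trans (le_trans ?_ (hKL x y))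
      exact ((le_max_left _ _).trans (le_max_right _ _)).trans (hK x y)
  · refine FourPoint.of_fderiv hf.differentiable_gradient (fun x => ?_) (fun x => ?_)
      (fun x y => ?_)
    · exact (norm_le_vecNorm1 _).trans ((hb x).2.2.1.trans (le_max_left _ _))
    · exact (opNorm_le_sum_abs _).trans ((hb x).2.2.2.trans (le_max_left _ _))
    · refine (opNorm_le_sum_abs _).trans (le_trans (le_of_eq ?_)
        ((((le_max_right _ _).trans (le_max_right _ _)).trans (hK x y)).trans (hKL x y)))
      simp [matNorm1, hessian]

/-! ### Averages over shifted samples. -/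

/-- The average of `g (x + s z)` over `z ∼ μ`. -/
def shiftMean {d : ℕ} {V : Type*} [NormedAddCommGroup V] [NormedSpace ℝ V] (μ : Measure (Vec d))
    (g : Vec d → V) (x : Vec d) (s : ℝ) : V :=
  ∫ z, g (x + s • z) ∂μ

section ShiftMean

variable {d : ℕ} {V : Type*} [NormedAddCommGroup V] [NormedSpace ℝ V] {g : Vec d → V} {L : ℝ}
  {μ : Measure (Vec d)} [IsProbabilityMeasure μ]

omit [NormedSpace ℝ V] in
lemma FourPoint.integrable_shift (hg : FourPoint g L) (x : Vec d) (s : ℝ) :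
    Integrable (fun z => g (x + s • z)) μ :=
  (integrable_const L).mono' (hg.continuous.comp (by fun_prop)).aestronglyMeasurable
    (Filter.Eventually.of_forall fun _ => hg.bound _)

lemma norm_shiftMean_le (hg : FourPoint g L) (x : Vec d) (s : ℝ) :
    ‖shiftMean μ g x s‖ ≤ L := by
  simpa [shiftMean] using norm_integral_le_of_norm_le_const (μ := μ)
    (Filter.Eventually.of_forall fun z => hg.bound (x + s • z))

lemma le_shiftMean {f : Vec d → ℝ} (hf : FourPoint f L) {c : ℝ} (hc : ∀ x, c ≤ f x) (x : Vec d)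
    (s : ℝ) : c ≤ shiftMean μ f x s := by
  simpa [shiftMean] using integral_mono (μ := μ) (integrable_const c) (hf.integrable_shift x s)
    (fun z => hc _)

omit [NormedSpace ℝ V] in
lemma FourPoint.norm_shift_sub_le (hg : FourPoint g L) (x y z : Vec d) (s s' : ℝ) :
    ‖g (x + s • z) - g (y + s' • z)‖ ≤ L * (‖x - y‖ + |s - s'| * ‖z‖) := by
  refine (hg.lip _ _).trans (mul_le_mul_of_nonneg_left ?_ hg.nonneg)
  rw [add_sub_add_comm, ← sub_smul, ← Real.norm_eq_abs, ← norm_smul]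
  exact norm_add_le _ _

lemma norm_shiftMean_sub_le (hg : FourPoint g L) (hμ : Integrable (fun z : Vec d => ‖z‖) μ)
    (x y : Vec d) (s s' : ℝ) :
    ‖shiftMean μ g x s - shiftMean μ g y s'‖ ≤ L * (‖x - y‖ + |s - s'| * ∫ z, ‖z‖ ∂μ) := by
  rw [shiftMean, shiftMean, ← integral_sub (hg.integrable_shift x s) (hg.integrable_shift y s')]
  have hi : Integrable (fun z : Vec d => L * (‖x - y‖ + |s - s'| * ‖z‖)) μ :=
    ((integrable_const _).add (hμ.const_mul _)).const_mul _
  refine (norm_integral_le_of_norm_le hi (Filter.Eventually.of_forall fun z =>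
    hg.norm_shift_sub_le x y z s s')).trans (le_of_eq ?_)
  rw [integral_const_mul, integral_add (integrable_const _) (hμ.const_mul _), integral_const_mul]
  simp

/-- Points 1, 3 share the shift `s' • z` and points 2, 4 the shift `s • z`. The shifts cancel
everywhere except in the difference of points 3 and 4, so only the first moment of `μ` appears. -/
lemma norm_shiftMean_four_point_le (hg : FourPoint g L)
    (hμ : Integrable (fun z : Vec d => ‖z‖) μ) (x₁ x₂ x₃ x₄ : Vec d) (s s' : ℝ) :
    ‖shiftMean μ g x₁ s' - shiftMean μ g x₂ s - shiftMean μ g x₃ s' + shiftMean μ g x₄ s‖ ≤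
      L * (‖x₁ - x₂ - x₃ + x₄‖ + (‖x₁ - x₃‖ + ‖x₂ - x₄‖)
        * (‖x₃ - x₄‖ + |s' - s| * ∫ z, ‖z‖ ∂μ)) := by
  have i₁ := hg.integrable_shift (μ := μ) x₁ s'
  have i₂ := hg.integrable_shift (μ := μ) x₂ s
  have i₃ := hg.integrable_shift (μ := μ) x₃ s'
  have i₄ := hg.integrable_shift (μ := μ) x₄ s
  simp only [shiftMean]
  rw [← integral_sub i₁ i₂,
    ← integral_sub (f := fun z => g (x₁ + s' • z) - g (x₂ + s • z)) (i₁.sub i₂) i₃,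
    ← integral_add (f := fun z => g (x₁ + s' • z) - g (x₂ + s • z) - g (x₃ + s' • z))
      ((i₁.sub i₂).sub i₃) i₄]
  have hi : Integrable (fun z : Vec d => L * (‖x₁ - x₂ - x₃ + x₄‖ + (‖x₁ - x₃‖ + ‖x₂ - x₄‖)
        * (‖x₃ - x₄‖ + |s' - s| * ‖z‖))) μ :=
    ((integrable_const _).add
      (((integrable_const _).add (hμ.const_mul _)).const_mul _)).const_mul _
  refine (norm_integral_le_of_norm_le hi (Filter.Eventually.of_forall fun z => ?_)).trans
    (le_of_eq ?_)
  · refine (hg.four_point _ _ _ _).trans (mul_le_mul_of_nonneg_left ?_ hg.nonneg)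
    rw [add_sub_add_right_eq_sub, add_sub_add_right_eq_sub,
      show x₁ + s' • z - (x₂ + s • z) - (x₃ + s' • z) + (x₄ + s • z) = x₁ - x₂ - x₃ + x₄ by abel,
      add_sub_add_comm, ← sub_smul, ← Real.norm_eq_abs, ← norm_smul]
    gcongr
    exact norm_add_le _ _
  · have i₅ : Integrable (fun z : Vec d => (‖x₁ - x₃‖ + ‖x₂ - x₄‖)
        * (‖x₃ - x₄‖ + |s' - s| * ‖z‖)) μ :=
      ((integrable_const _).add (hμ.const_mul _)).const_mul _
    rw [integral_const_mul, integral_add (integrable_const _) i₅, integral_const_mul,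
      integral_add (integrable_const _) (hμ.const_mul _), integral_const_mul]
    simp

end ShiftMean

/-! ### Stability of quotients under perturbation. -/

section Ratio

variable {V : Type*} [NormedAddCommGroup V] [NormedSpace ℝ V] {c L : ℝ}

lemma norm_ratio_le (hc : 0 < c) {F : ℝ} {G : V} (hF : c ≤ F) (hG : ‖G‖ ≤ L) :
    ‖F⁻¹ • G‖ ≤ L / c := by
  rw [norm_smul, norm_inv, Real.norm_of_nonneg (hc.le.trans hF), div_eq_inv_mul]
  gcongr

lemma norm_inv_smul_le (hc : 0 < c) {F : ℝ} (hF : c ≤ F) (v : V) : ‖F⁻¹ • v‖ ≤ c⁻¹ * ‖v‖ := by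
  rw [norm_smul, norm_inv, Real.norm_of_nonneg (hc.le.trans hF)]
  gcongr

lemma norm_ratio_sub_le (hc : 0 < c) {F F' : ℝ} {G G' : V} (hF : c ≤ F) (hF' : c ≤ F')
    (hG' : ‖G'‖ ≤ L) :
    ‖F⁻¹ • G - F'⁻¹ • G'‖ ≤ c⁻¹ * (‖G - G'‖ + |F - F'| * (L / c)) := by
  have h0 : F ≠ 0 := (hc.trans_le hF).ne'
  have h0' : F' ≠ 0 := (hc.trans_le hF').ne'
  have e : F⁻¹ • G - F'⁻¹ • G' = F⁻¹ • ((G - G') - (F - F') • (F'⁻¹ • G')) := by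
    have a1 := smul_inv_smul₀ h0' G'
    have a2 := inv_smul_smul₀ h0 (F'⁻¹ • G')
    generalize F'⁻¹ • G' = q at *
    subst a1
    rw [sub_smul, sub_sub_sub_cancel_right, smul_sub, a2]
  rw [e]
  refine (norm_inv_smul_le hc hF _).trans ?_
  gcongr
  refine (norm_sub_le _ _).trans ?_
  rw [norm_smul, Real.norm_eq_abs]
  gcongr
  exact norm_ratio_le hc hF' hG'

/-- A discrete second-order product rule for `F • q`, solved for the second difference of `q`. -/
lemma ratio_four_point_identity {F₁ F₂ F₃ F₄ : ℝ} {q₁ q₂ q₃ q₄ : V} :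
    F₂ • (q₁ - q₂ - q₃ + q₄) = (F₁ • q₁ - F₂ • q₂ - F₃ • q₃ + F₄ • q₄)
      - (F₁ - F₂ - F₃ + F₄) • q₁ - (F₃ - F₄) • (q₁ - q₃) - (F₂ - F₄) • (q₃ - q₄) := by
  module

/-- In the application `v` is the norm of the second difference of the points, `e` the distance
between approximate and exact points, and `ρ` the space-time gap between levels. -/
lemma norm_ratio_four_point_le (hc : 0 < c) {F₁ F₂ F₃ F₄ : ℝ} {G₁ G₂ G₃ G₄ : V} {v e ρ : ℝ}
    (hL : 0 ≤ L) (hv : 0 ≤ v) (he : 0 ≤ e) (hρ : 0 ≤ ρ)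
    (hF₁ : c ≤ F₁) (hF₂ : c ≤ F₂) (hF₃ : c ≤ F₃) (hF₄ : c ≤ F₄)
    (hG₁ : ‖G₁‖ ≤ L) (hG₃ : ‖G₃‖ ≤ L) (hG₄ : ‖G₄‖ ≤ L)
    (hF₁₃ : |F₁ - F₃| ≤ L * e) (hG₁₃ : ‖G₁ - G₃‖ ≤ L * e) (hF₂₄ : |F₂ - F₄| ≤ L * e)
    (hF₃₄ : |F₃ - F₄| ≤ L * ρ) (hG₃₄ : ‖G₃ - G₄‖ ≤ L * ρ)
    (hF : |F₁ - F₂ - F₃ + F₄| ≤ L * (v + e * ρ)) (hG : ‖G₁ - G₂ - G₃ + G₄‖ ≤ L * (v + e * ρ)) :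
    ‖F₁⁻¹ • G₁ - F₂⁻¹ • G₂ - F₃⁻¹ • G₃ + F₄⁻¹ • G₄‖ ≤
      c⁻¹ * (L + L * (L / c) + 2 * L * (c⁻¹ * (L + L * (L / c)))) * (v + e * ρ) := by
  have hq₁ := norm_ratio_le hc hF₁ hG₁
  have hq₁₃ := norm_ratio_sub_le (G := G₁) hc hF₁ hF₃ hG₃
  have hq₃₄ := norm_ratio_sub_le (G := G₃) hc hF₃ hF₄ hG₄
  have hLc : 0 ≤ L / c := by positivity
  have hΛ : 0 ≤ c⁻¹ * (L + L * (L / c)) := by positivity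
  have hq₁₃' : ‖F₁⁻¹ • G₁ - F₃⁻¹ • G₃‖ ≤ c⁻¹ * (L + L * (L / c)) * e := by
    refine hq₁₃.trans ?_
    rw [mul_assoc]
    refine mul_le_mul_of_nonneg_left ?_ (by positivity)
    nlinarith [mul_le_mul_of_nonneg_right hF₁₃ hLc]
  have hq₃₄' : ‖F₃⁻¹ • G₃ - F₄⁻¹ • G₄‖ ≤ c⁻¹ * (L + L * (L / c)) * ρ := by
    refine hq₃₄.trans ?_
    rw [mul_assoc]
    refine mul_le_mul_of_nonneg_left ?_ (by positivity)
    nlinarith [mul_le_mul_of_nonneg_right hF₃₄ hLc]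
  have hne : ∀ {F : ℝ}, c ≤ F → ∀ G : V, F • F⁻¹ • G = G := fun h G =>
    smul_inv_smul₀ (hc.trans_le h).ne' G
  have key := ratio_four_point_identity (F₁ := F₁) (F₂ := F₂) (F₃ := F₃) (F₄ := F₄)
    (q₁ := F₁⁻¹ • G₁) (q₂ := F₂⁻¹ • G₂) (q₃ := F₃⁻¹ • G₃) (q₄ := F₄⁻¹ • G₄)
  rw [hne hF₁, hne hF₂, hne hF₃, hne hF₄] at key
  have e0 := congrArg (fun u => F₂⁻¹ • u) key
  simp only [inv_smul_smul₀ (hc.trans_le hF₂).ne'] at e0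
  rw [e0, mul_assoc]
  refine (norm_inv_smul_le hc hF₂ _).trans (mul_le_mul_of_nonneg_left ?_ (by positivity))
  refine (norm_sub_le _ _).trans ?_
  refine (add_le_add_left ((norm_sub_le _ _).trans (add_le_add_left (norm_sub_le _ _) _)) _).trans ?_
  simp only [norm_smul (F₁ - F₂ - F₃ + F₄), norm_smul (F₃ - F₄), norm_smul (F₂ - F₄),
    Real.norm_eq_abs]
  have m1 := mul_le_mul hF hq₁ (norm_nonneg _) (by positivity)
  have m2 := mul_le_mul hF₃₄ hq₁₃' (norm_nonneg _) (by positivity)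
  have m3 := mul_le_mul hF₂₄ hq₃₄' (norm_nonneg _) (by positivity)
  have m4 : 0 ≤ 2 * L * (c⁻¹ * (L + L * (L / c))) * v := by positivity
  linarith

/-- The error of a ratio whose numerator and denominator are perturbed, at two points. -/
lemma norm_ratio_dev_sub_le (hc : 0 < c) {F₁ F₂ F₁' F₂' : ℝ} {G₁ G₂ G₁' G₂' : V} {ρ : ℝ}
    (hL : 0 ≤ L) (hρ : 0 ≤ ρ)
    (hF₁ : c ≤ F₁) (hF₂ : c ≤ F₂) (hF₁' : c ≤ F₁') (hF₂' : c ≤ F₂')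
    (hG₁ : ‖G₁‖ ≤ L) (hG₂ : ‖G₂‖ ≤ L) (hG₂' : ‖G₂'‖ ≤ L)
    (hF : |F₁ - F₂| ≤ L * ρ) (hG : ‖G₁ - G₂‖ ≤ L * ρ) :
    ‖(F₁'⁻¹ • G₁' - F₁⁻¹ • G₁) - (F₂'⁻¹ • G₂' - F₂⁻¹ • G₂)‖ ≤
      c⁻¹ * (‖(G₁' - G₁) - (G₂' - G₂)‖ + 3 * (L / c) * |(F₁' - F₁) - (F₂' - F₂)|
        + c⁻¹ * (L + L * (L / c)) * ρ * |F₂' - F₂|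
        + L * ρ * (c⁻¹ * (‖G₂' - G₂‖ + |F₂' - F₂| * (L / c)))) := by
  have hLc : 0 ≤ L / c := by positivity
  have hne : ∀ {F : ℝ}, c ≤ F → ∀ G : V, F • F⁻¹ • G = G := fun h G =>
    smul_inv_smul₀ (hc.trans_le h).ne' G
  have hq : ‖F₁⁻¹ • G₁ - F₂⁻¹ • G₂‖ ≤ c⁻¹ * (L + L * (L / c)) * ρ := by
    refine (norm_ratio_sub_le (G := G₁) hc hF₁ hF₂ hG₂).trans ?_
    rw [mul_assoc]
    refine mul_le_mul_of_nonneg_left ?_ (by positivity)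
    nlinarith [mul_le_mul_of_nonneg_right hF hLc]
  have hq₁ := norm_ratio_le hc hF₁ hG₁
  have hδ := norm_ratio_sub_le (G := G₂') hc hF₂' hF₂ hG₂
  have hδ' := (norm_sub_le (F₂'⁻¹ • G₂') (F₂⁻¹ • G₂)).trans
    (add_le_add (norm_ratio_le hc hF₂' hG₂') (norm_ratio_le hc hF₂ hG₂))
  -- The terms are arranged so that, of any two factors multiplied, one has a bound free of the
  -- perturbation errors.
  have key : F₁' • ((F₁'⁻¹ • G₁' - F₁⁻¹ • G₁) - (F₂'⁻¹ • G₂' - F₂⁻¹ • G₂))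
      = ((G₁' - G₁) - (G₂' - G₂)) - ((F₁' - F₁) - (F₂' - F₂)) • (F₁⁻¹ • G₁)
        - (F₂' - F₂) • (F₁⁻¹ • G₁ - F₂⁻¹ • G₂)
        - ((F₁' - F₁) - (F₂' - F₂)) • (F₂'⁻¹ • G₂' - F₂⁻¹ • G₂)
        - (F₁ - F₂) • (F₂'⁻¹ • G₂' - F₂⁻¹ • G₂) := by
    have a1 := hne hF₁ G₁
    have a2 := hne hF₂ G₂
    have a3 := hne hF₁' G₁'
    have a4 := hne hF₂' G₂'
    generalize F₁⁻¹ • G₁ = q₁ at *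
    generalize F₂⁻¹ • G₂ = q₂ at *
    generalize F₁'⁻¹ • G₁' = q₁' at *
    generalize F₂'⁻¹ • G₂' = q₂' at *
    subst a1 a2 a3 a4
    module
  have e0 := congrArg (fun u => F₁'⁻¹ • u) key
  simp only [inv_smul_smul₀ (hc.trans_le hF₁').ne'] at e0
  rw [e0]
  refine (norm_inv_smul_le hc hF₁' _).trans (mul_le_mul_of_nonneg_left ?_ (by positivity))
  refine (norm_sub_le _ _).trans ?_
  refine (add_le_add_left ((norm_sub_le _ _).trans (add_le_add_left ((norm_sub_le _ _).trans
    (add_le_add_left (norm_sub_le _ _) _)) _)) _).trans ?_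
  simp only [norm_smul ((F₁' - F₁) - (F₂' - F₂)), norm_smul (F₂' - F₂), norm_smul (F₁ - F₂),
    Real.norm_eq_abs]
  have m1 := mul_le_mul_of_nonneg_left hq₁ (abs_nonneg ((F₁' - F₁) - (F₂' - F₂)))
  have m2 := mul_le_mul_of_nonneg_left hq (abs_nonneg (F₂' - F₂))
  -- The quotient error is bounded crudely by `2 * (L / c)` here, which avoids a product of two
  -- fluctuations; with `m1` this makes the factor 3.
  have m3 := mul_le_mul_of_nonneg_left hδ' (abs_nonneg ((F₁' - F₁) - (F₂' - F₂)))
  have m4 := mul_le_mul hF hδ (norm_nonneg _) (by positivity)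
  linarith

end Ratio

/-! ### Both drifts as one functional of the sampling measure. -/

/-- The drift formula with the average over `z ∼ μ`. -/
def ratioDrift {d : ℕ} (μ : Measure (Vec d)) (f : Vec d → ℝ) (x : Vec d) (t : ℝ) : Vec d :=
  (shiftMean μ f x √(1 - t))⁻¹ • shiftMean μ (gradient f) x √(1 - t)

/-- Differentiation under the integral sign, dominated by the constant `L`. -/
lemma hasGradientAt_shiftMean {d : ℕ} {f : Vec d → ℝ} {L : ℝ} (hd : Differentiable ℝ f)
    (hf : FourPoint f L) (hg : FourPoint (gradient f) L) (μ : Measure (Vec d))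
    [IsProbabilityMeasure μ] (x : Vec d) (s : ℝ) :
    HasGradientAt (fun y => shiftMean μ f y s) (shiftMean μ (gradient f) x s) x := by
  have hfd : ∀ x, fderiv ℝ f x = InnerProductSpace.toDual ℝ (Vec d) (gradient f x) := fun x =>
    (hd x).hasGradientAt.hasFDerivAt.fderiv
  have hcont : Continuous (fderiv ℝ f) := by
    rw [show fderiv ℝ f = fun x => InnerProductSpace.toDual ℝ (Vec d) (gradient f x)
      from funext hfd]
    exact (InnerProductSpace.toDual ℝ (Vec d)).continuous.comp hg.continuous
  have hm : AEStronglyMeasurable (fun z => fderiv ℝ f (x + s • z)) μ :=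
    (hcont.comp (by fun_prop)).aestronglyMeasurable
  have hbd : ∀ y, ‖fderiv ℝ f y‖ ≤ L := fun y => by
    rw [hfd, LinearIsometryEquiv.norm_map]; exact hg.bound _
  have key := hasFDerivAt_integral_of_dominated_of_fderiv_le (μ := μ) (𝕜 := ℝ)
    (F := fun y z => f (y + s • z)) (F' := fun y z => fderiv ℝ f (y + s • z)) (x₀ := x)
    (s := Set.univ) (bound := fun _ => L) Filter.univ_mem
    (Filter.Eventually.of_forall fun y => (hf.integrable_shift y s).aestronglyMeasurable)
    (hf.integrable_shift x s) hm
    (Filter.Eventually.of_forall fun z y _ => hbd _) (integrable_const L)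
    (Filter.Eventually.of_forall fun z y _ => by
      rw [hasFDerivAt_comp_add_right]
      exact (hd _).hasFDerivAt)
  rw [hasGradientAt_iff_hasFDerivAt]
  have hi : Integrable (fun z => fderiv ℝ f (x + s • z)) μ :=
    (integrable_const L).mono' hm (Filter.Eventually.of_forall fun _ => hbd _)
  have hG : InnerProductSpace.toDual ℝ (Vec d) (shiftMean μ (gradient f) x s)
      = ∫ z, fderiv ℝ f (x + s • z) ∂μ := by
    ext v
    rw [ContinuousLinearMap.integral_apply hi, InnerProductSpace.toDual_apply_apply, shiftMean,
      real_inner_comm, ← integral_inner (hg.integrable_shift x s)]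
    refine integral_congr_ae (Filter.Eventually.of_forall fun z => ?_)
    simp only [hfd, InnerProductSpace.toDual_apply_apply]
    exact real_inner_comm _ _
  rw [hG]
  exact key

lemma drift_eq_ratioDrift {d : ℕ} {f : Vec d → ℝ} {c L : ℝ} (hd : Differentiable ℝ f) (hc : 0 < c)
    (hcf : ∀ x, c ≤ f x) (hf : FourPoint f L) (hg : FourPoint (gradient f) L) (x : Vec d) (t : ℝ) :
    drift f x t = ratioDrift (stdGaussian (Vec d)) f x t := by
  have h1 := (hasGradientAt_shiftMean hd hf hg (stdGaussian (Vec d)) x √(1 - t)).hasFDerivAt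
  have h2 := h1.log (hc.trans_le (le_shiftMean hf hcf x _)).ne'
  refine HasGradientAt.gradient ?_
  rw [hasGradientAt_iff_hasFDerivAt]
  have e : InnerProductSpace.toDual ℝ (Vec d) (ratioDrift (stdGaussian (Vec d)) f x t)
      = (shiftMean (stdGaussian (Vec d)) f x √(1 - t))⁻¹ • InnerProductSpace.toDual ℝ (Vec d)
        (shiftMean (stdGaussian (Vec d)) (gradient f) x √(1 - t)) := by
    simp [ratioDrift]
  rw [e]
  exact h2

/-- No sign condition is needed because `Real.sqrt` vanishes on negative numbers; the drift
estimates can thus be stated for all real times. -/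
lemma abs_sqrt_sub_sqrt_le (a b : ℝ) : |√a - √b| ≤ √|a - b| := by
  wlog h : b ≤ a generalizing a b
  · rw [abs_sub_comm, abs_sub_comm a]
    exact this b a (le_of_not_ge h)
  rw [abs_of_nonneg (sub_nonneg.2 (Real.sqrt_le_sqrt h)), abs_of_nonneg (sub_nonneg.2 h),
    sub_le_iff_le_add]
  rcases le_total 0 b with hb | hb
  · refine Real.sqrt_le_iff.2 ⟨by positivity, ?_⟩
    nlinarith [Real.sq_sqrt hb, Real.sq_sqrt (sub_nonneg.2 h), Real.sqrt_nonneg b,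
      Real.sqrt_nonneg (a - b), mul_nonneg (Real.sqrt_nonneg b) (Real.sqrt_nonneg (a - b))]
  · rw [Real.sqrt_eq_zero_of_nonpos hb, add_zero]
    exact Real.sqrt_le_sqrt (by linarith)

lemma abs_sqrt_one_sub_sub_le (t t' : ℝ) : |√(1 - t) - √(1 - t')| ≤ √|t - t'| := by
  refine (abs_sqrt_sub_sqrt_le _ _).trans (le_of_eq ?_)
  rw [sub_sub_sub_cancel_left, abs_sub_comm]

section RatioDrift

variable {d : ℕ} {f : Vec d → ℝ} {c L : ℝ} {μ : Measure (Vec d)} [IsProbabilityMeasure μ]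

lemma norm_ratioDrift_le (hc : 0 < c) (hcf : ∀ x, c ≤ f x) (hf : FourPoint f L)
    (hg : FourPoint (gradient f) L) (x : Vec d) (t : ℝ) : ‖ratioDrift μ f x t‖ ≤ L / c :=
  norm_ratio_le hc (le_shiftMean hf hcf x _) (norm_shiftMean_le hg x _)

lemma norm_ratioDrift_sub_le (hc : 0 < c) (hcf : ∀ x, c ≤ f x) (hf : FourPoint f L)
    (hg : FourPoint (gradient f) L) (hμ : Integrable (fun z : Vec d => ‖z‖) μ)
    (x y : Vec d) (t t' : ℝ) :
    ‖ratioDrift μ f x t - ratioDrift μ f y t'‖ ≤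
      c⁻¹ * (L + L * (L / c)) * (‖x - y‖ + √|t - t'| * ∫ z, ‖z‖ ∂μ) := by
  have hL := hf.nonneg
  have hm : 0 ≤ ∫ z, ‖z‖ ∂μ := integral_nonneg fun _ => norm_nonneg _
  have h1 := norm_shiftMean_sub_le hf hμ x y √(1 - t) √(1 - t')
  have h2 := norm_shiftMean_sub_le hg hμ x y √(1 - t) √(1 - t')
  have hs : L * (‖x - y‖ + |√(1 - t) - √(1 - t')| * ∫ z, ‖z‖ ∂μ) ≤
      L * (‖x - y‖ + √|t - t'| * ∫ z, ‖z‖ ∂μ) := by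
    gcongr
    exact abs_sqrt_one_sub_sub_le t t'
  refine (norm_ratio_sub_le hc (le_shiftMean hf hcf x _) (le_shiftMean hf hcf y _)
    (norm_shiftMean_le hg y _)).trans ?_
  rw [mul_assoc]
  refine mul_le_mul_of_nonneg_left ?_ (by positivity)
  have h3 := mul_le_mul_of_nonneg_right (h1.trans hs) (by positivity : 0 ≤ L / c)
  rw [Real.norm_eq_abs] at h3
  linarith

lemma norm_ratioDrift_four_point_le (hc : 0 < c) (hcf : ∀ x, c ≤ f x) (hf : FourPoint f L)
    (hg : FourPoint (gradient f) L) (hμ : Integrable (fun z : Vec d => ‖z‖) μ)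
    (x₁ x₂ x₃ x₄ : Vec d) (t t' : ℝ) :
    ‖ratioDrift μ f x₁ t' - ratioDrift μ f x₂ t - ratioDrift μ f x₃ t' + ratioDrift μ f x₄ t‖ ≤
      c⁻¹ * (L + L * (L / c) + 2 * L * (c⁻¹ * (L + L * (L / c)))) * (‖x₁ - x₂ - x₃ + x₄‖ +
        (‖x₁ - x₃‖ + ‖x₂ - x₄‖) * (‖x₃ - x₄‖ + √|t' - t| * ∫ z, ‖z‖ ∂μ)) := by
  have hL := hf.nonneg
  have hm : 0 ≤ ∫ z, ‖z‖ ∂μ := integral_nonneg fun _ => norm_nonneg _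
  have hs := abs_sqrt_one_sub_sub_le t' t
  have hρ : ‖x₃ - x₄‖ + |√(1 - t') - √(1 - t)| * ∫ z, ‖z‖ ∂μ ≤
      ‖x₃ - x₄‖ + √|t' - t| * ∫ z, ‖z‖ ∂μ := by gcongr
  -- The pairs 1, 3 and 2, 4 each share a time, so their gaps involve no moment of `μ`.
  have space : ∀ {V : Type} [NormedAddCommGroup V] [NormedSpace ℝ V] {g : Vec d → V}
      (_ : FourPoint g L) (x y : Vec d) (s : ℝ),
      ‖shiftMean μ g x s - shiftMean μ g y s‖ ≤ L * ‖x - y‖ := by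
    intro V _ _ g hg x y s
    simpa using norm_shiftMean_sub_le hg hμ x y s s
  have e1 : ‖x₁ - x₃‖ ≤ ‖x₁ - x₃‖ + ‖x₂ - x₄‖ := by linarith [norm_nonneg (x₂ - x₄)]
  have e2 : ‖x₂ - x₄‖ ≤ ‖x₁ - x₃‖ + ‖x₂ - x₄‖ := by linarith [norm_nonneg (x₁ - x₃)]
  refine norm_ratio_four_point_le hc hL (norm_nonneg _) (by positivity) (by positivity)
    (le_shiftMean hf hcf _ _) (le_shiftMean hf hcf _ _) (le_shiftMean hf hcf _ _)
    (le_shiftMean hf hcf _ _) (norm_shiftMean_le hg _ _) (norm_shiftMean_le hg _ _)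
    (norm_shiftMean_le hg _ _)
    ((space hf _ _ _).trans (mul_le_mul_of_nonneg_left e1 hL))
    ((space hg _ _ _).trans (mul_le_mul_of_nonneg_left e1 hL))
    ((space hf _ _ _).trans (mul_le_mul_of_nonneg_left e2 hL))
    ((norm_shiftMean_sub_le hf hμ _ _ _ _).trans (mul_le_mul_of_nonneg_left hρ hL))
    ((norm_shiftMean_sub_le hg hμ _ _ _ _).trans (mul_le_mul_of_nonneg_left hρ hL))
    ((norm_shiftMean_four_point_le hf hμ _ _ _ _ _ _).trans ?_)
    ((norm_shiftMean_four_point_le hg hμ _ _ _ _ _ _).trans ?_) <;> gcongr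

end RatioDrift

/-! ### Empirical measures and Monte Carlo errors. -/

namespace L2Bound

variable {α : Type*} [MeasurableSpace α] {μ : Measure α} {g : α → ℝ} {K : ℝ}

lemma of_variance_le [IsFiniteMeasure μ] (hg : MemLp g 2 μ) (hK : 0 ≤ K)
    (h : Var[g; μ] ≤ K ^ 2) : L2Bound μ (fun z => |g z - ∫ z, g z ∂μ|) K := by
  refine L2Bound.of_lintegral_sq_le hK
    (hg.aestronglyMeasurable.sub aestronglyMeasurable_const).norm ?_
  simp only [sq_abs]
  rw [← evariance_eq_lintegral_ofReal, ← ofReal_variance hg]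
  exact ENNReal.ofReal_le_ofReal h

lemma memLp (h : L2Bound μ g K) : MemLp g 2 μ :=
  ⟨h.aesm, h.eLpNorm_le.trans_lt ENNReal.ofReal_lt_top⟩

lemma integral_sq_le (h : L2Bound μ g K) : ∫ z, g z ^ 2 ∂μ ≤ K ^ 2 := by
  rw [integral_eq_lintegral_of_nonneg_ae (Filter.Eventually.of_forall fun z => sq_nonneg _)
    (h.aesm.pow 2)]
  exact ENNReal.toReal_le_of_le_ofReal (sq_nonneg K) h.lintegral_sq_le

end L2Bound

/-- The empirical measure of the sample `z`. -/
def empirical {d N : ℕ} (z : Fin N → Vec d) : Measure (Vec d) :=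
  (N : ENNReal)⁻¹ • ∑ i, Measure.dirac (z i)

lemma isProbabilityMeasure_empirical {d N : ℕ} (hN : 1 ≤ N) (z : Fin N → Vec d) :
    IsProbabilityMeasure (empirical z) where
  measure_univ := by
    have h0 : (N : ENNReal) ≠ 0 := by exact_mod_cast (by omega : N ≠ 0)
    simp [empirical, ENNReal.inv_mul_cancel h0 (ENNReal.natCast_ne_top N)]

lemma integral_empirical {d N : ℕ} {V : Type*} [NormedAddCommGroup V] [NormedSpace ℝ V]
    [CompleteSpace V] (z : Fin N → Vec d) (g : Vec d → V) :
    ∫ x, g x ∂(empirical z) = (1 / (N : ℝ)) • ∑ i, g (z i) := by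
  rw [empirical, integral_smul_measure,
    integral_finsetSum_measure fun i _ => integrable_dirac (by simp)]
  simp

lemma integrable_empirical {d N : ℕ} (hN : 1 ≤ N) {V : Type*} [NormedAddCommGroup V]
    (z : Fin N → Vec d) (g : Vec d → V) : Integrable g (empirical z) := by
  refine Integrable.smul_measure (integrable_finsetSum_measure.2 fun i _ =>
    integrable_dirac (by simp)) ?_
  have h0 : (N : ENNReal) ≠ 0 := by exact_mod_cast (by omega : N ≠ 0)
  exact ENNReal.inv_ne_top.2 h0

/-- Makes the deterministic regularity estimates for `ratioDrift` available for each sample. -/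
lemma driftMC_eq_ratioDrift {d N : ℕ} (f : Vec d → ℝ) (z : Fin N → Vec d) (x : Vec d) (t : ℝ) :
    driftMC f z x t = ratioDrift (empirical z) f x t := by
  rw [driftMC, ratioDrift, shiftMean, shiftMean, integral_empirical, integral_empirical,
    smul_eq_mul]

section Sample

variable {d : ℕ} {γ : Measure (Vec d)} [IsProbabilityMeasure γ] {σ : ℝ}

/-- The `L²` error of the empirical mean of a function of linear growth. -/
lemma empirical_dev_L2 (hσ : L2Bound γ (fun z => ‖z‖) σ) {N : ℕ} (hN : 1 ≤ N) {φ : Vec d → ℝ}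
    (hφ : Measurable φ) {a b : ℝ} (ha : 0 ≤ a) (hb : 0 ≤ b) (hle : ∀ z, |φ z| ≤ a + b * ‖z‖) :
    L2Bound (Measure.pi fun _ : Fin N => γ)
      (fun z => |∫ x, φ x ∂(empirical z) - ∫ x, φ x ∂γ|) ((a + b * σ) * (√N)⁻¹) := by
  have hN0 : (N : ℝ) ≠ 0 := by exact_mod_cast (by omega : N ≠ 0)
  have hL2 : L2Bound γ φ (a + b * σ) :=
    ((L2Bound.const ha).add (hσ.const_mul hb)).mono_fun hφ.aestronglyMeasurable hle
  have hmem := hL2.memLp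
  have hmemi : ∀ i : Fin N, MemLp (fun z : Fin N → Vec d => φ (z i)) 2
      (Measure.pi fun _ : Fin N => γ) := fun i =>
    hmem.comp_measurePreserving (measurePreserving_eval (fun _ : Fin N => γ) i)
  have hsum : MemLp (fun z : Fin N → Vec d => ∑ i, φ (z i)) 2 (Measure.pi fun _ : Fin N => γ) :=
    memLp_finsetSum _ fun i _ => hmemi i
  have hmean : ∫ z : Fin N → Vec d, (1 / (N : ℝ)) * ∑ i, φ (z i) ∂(Measure.pi fun _ => γ)
      = ∫ x, φ x ∂γ := by
    rw [integral_const_mul, integral_finsetSum _ fun i _ => (hmemi i).integrable (by norm_num)]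
    have : ∀ i : Fin N, ∫ z : Fin N → Vec d, φ (z i) ∂(Measure.pi fun _ => γ) = ∫ x, φ x ∂γ := by
      intro i
      conv_rhs => rw [← (measurePreserving_eval (fun _ : Fin N => γ) i).map_eq]
      rw [integral_map (measurable_pi_apply i).aemeasurable hφ.aestronglyMeasurable]
    simp only [this, Finset.sum_const, Finset.card_univ, Fintype.card_fin, nsmul_eq_mul]
    field_simp
  -- Variances of independent coordinates add, so the mean has variance `Var[φ; γ] / N`, and the
  -- variance is at most the second moment.
  have hvar : Var[fun z : Fin N → Vec d => (1 / (N : ℝ)) * ∑ i, φ (z i);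
      Measure.pi fun _ => γ] ≤ ((a + b * σ) * (√N)⁻¹) ^ 2 := by
    rw [variance_const_mul]
    have h1 := variance_sum_pi (μ := fun _ : Fin N => γ) (X := fun _ => φ) fun _ => hmem
    have h2 : (∑ i : Fin N, fun ω : Fin N → Vec d => φ (ω i)) = fun z => ∑ i, φ (z i) := by
      ext z; simp
    rw [h2] at h1
    rw [h1, Finset.sum_const, Finset.card_univ, Fintype.card_fin, nsmul_eq_mul, mul_pow, inv_pow,
      Real.sq_sqrt (Nat.cast_nonneg N)]
    have h3 : Var[φ; γ] ≤ (a + b * σ) ^ 2 := by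
      refine (variance_le_expectation_sq hφ.aestronglyMeasurable).trans ?_
      simpa using hL2.integral_sq_le
    have h4 : (1 / (N : ℝ)) ^ 2 * (N * Var[φ; γ]) = Var[φ; γ] * (N : ℝ)⁻¹ := by
      field_simp
    rw [h4]
    gcongr
  have hfin := L2Bound.of_variance_le (hsum.const_mul (1 / (N : ℝ)))
    (mul_nonneg hL2.nonneg (by positivity)) hvar
  rw [hmean] at hfin
  exact hfin.congr fun z => by rw [integral_empirical, smul_eq_mul]

/-- The `L²` error of the empirical mean of a vector-valued function of linear growth. -/
lemma empirical_dev_L2_vec (hσ : L2Bound γ (fun z => ‖z‖) σ) {N : ℕ} (hN : 1 ≤ N)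
    {φ : Vec d → Vec d} (hφ : Measurable φ) {a b : ℝ} (ha : 0 ≤ a) (hb : 0 ≤ b)
    (hle : ∀ z, ‖φ z‖ ≤ a + b * ‖z‖) :
    L2Bound (Measure.pi fun _ : Fin N => γ)
      (fun z => ‖∫ x, φ x ∂(empirical z) - ∫ x, φ x ∂γ‖) (d * ((a + b * σ) * (√N)⁻¹)) := by
  have hint : Integrable φ γ := by
    have hi : Integrable (fun z : Vec d => a + b * ‖z‖) γ :=
      (integrable_const _).add ((hσ.memLp.integrable (by norm_num)).const_mul _)
    exact hi.mono' hφ.aestronglyMeasurable (Filter.Eventually.of_forall hle)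
  have hcoord : ∀ j : Fin d, L2Bound (Measure.pi fun _ : Fin N => γ)
      (fun z => |∫ x, φ x j ∂(empirical z) - ∫ x, φ x j ∂γ|) ((a + b * σ) * (√N)⁻¹) := fun j =>
    empirical_dev_L2 hσ hN (by fun_prop) ha hb
      fun z => (PiLp.norm_apply_le (φ z) j).trans (hle z)
  -- Summing over coordinates through the ℓ¹ norm costs the factor `d`.
  have hsum := L2Bound.sum Finset.univ fun j _ => hcoord j
  rw [Finset.sum_const, Finset.card_univ, Fintype.card_fin, nsmul_eq_mul] at hsum
  refine hsum.mono_fun ?_ fun z => ?_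
  · simp only [integral_empirical]
    have : Measurable fun z : Fin N → Vec d => (1 / (N : ℝ)) • ∑ i, φ (z i) := by fun_prop
    exact (this.sub_const _).norm.aestronglyMeasurable
  · rw [abs_norm]
    refine (norm_le_vecNorm1 _).trans (le_of_eq ?_)
    refine Finset.sum_congr rfl fun j _ => ?_
    have e : ∀ {ν : Measure (Vec d)}, Integrable φ ν → (∫ x, φ x ∂ν) j = ∫ x, φ x j ∂ν :=
      fun h => ((EuclideanSpace.proj (𝕜 := ℝ) j).integral_comp_comm h).symm
    rw [PiLp.sub_apply, e hint, e (integrable_empirical hN z φ)]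

end Sample

lemma empirical_mean_dev_L2 {d : ℕ} {γ : Measure (Vec d)} [IsProbabilityMeasure γ] {σ : ℝ}
    (hσ : L2Bound γ (fun z => ‖z‖) σ) {N : ℕ} (hN : 1 ≤ N) {f : Vec d → ℝ} {L : ℝ}
    (hf : FourPoint f L) (x : Vec d) (s : ℝ) :
    L2Bound (Measure.pi fun _ : Fin N => γ)
      (fun z => |shiftMean (empirical z) f x s - shiftMean γ f x s|) (L * (√N)⁻¹) := by
  have := empirical_dev_L2 hσ hN (φ := fun z => f (x + s • z))
    (hf.continuous.comp (by fun_prop)).measurable hf.nonneg le_rfl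
    (fun z => by simpa using hf.bound (x + s • z))
  simpa [shiftMean] using this

/-- The difference of the two errors is the Monte Carlo error of the single function `f (x + s • z)
- f (y + s' • z)`, which is small by the Lipschitz bound. This yields the distance factor on top of
`(√N)⁻¹`. -/
lemma empirical_mean_dev_sub_L2 {d : ℕ} {γ : Measure (Vec d)} [IsProbabilityMeasure γ] {σ : ℝ}
    (hσ : L2Bound γ (fun z => ‖z‖) σ) {N : ℕ} (hN : 1 ≤ N) {f : Vec d → ℝ} {L : ℝ}
    (hf : FourPoint f L) (x y : Vec d) (s s' : ℝ) :
    L2Bound (Measure.pi fun _ : Fin N => γ)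
      (fun z => |(shiftMean (empirical z) f x s - shiftMean γ f x s)
        - (shiftMean (empirical z) f y s' - shiftMean γ f y s')|)
      (L * (‖x - y‖ + |s - s'| * σ) * (√N)⁻¹) := by
  have hL := hf.nonneg
  have := empirical_dev_L2 hσ hN (φ := fun z => f (x + s • z) - f (y + s' • z))
    (a := L * ‖x - y‖) (b := L * |s - s'|)
    ((hf.continuous.comp (by fun_prop)).sub (hf.continuous.comp (by fun_prop))).measurable
    (by positivity) (by positivity)
    (fun z => (hf.norm_shift_sub_le x y z s s').trans (by rw [mul_add, mul_assoc]))
  refine (this.congr fun z => ?_).mono (le_of_eq (by ring))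
  rw [integral_sub (μ := γ) (hf.integrable_shift x s) (hf.integrable_shift y s'),
    integral_sub (integrable_empirical hN z _) (integrable_empirical hN z _)]
  simp only [shiftMean]
  congr 1
  ring

lemma empirical_mean_dev_L2_vec {d : ℕ} {γ : Measure (Vec d)} [IsProbabilityMeasure γ] {σ : ℝ}
    (hσ : L2Bound γ (fun z => ‖z‖) σ) {N : ℕ} (hN : 1 ≤ N) {f : Vec d → Vec d} {L : ℝ}
    (hf : FourPoint f L) (x : Vec d) (s : ℝ) :
    L2Bound (Measure.pi fun _ : Fin N => γ)
      (fun z => ‖shiftMean (empirical z) f x s - shiftMean γ f x s‖) (d * (L * (√N)⁻¹)) := by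
  have := empirical_dev_L2_vec hσ hN (φ := fun z => f (x + s • z))
    (hf.continuous.comp (by fun_prop)).measurable hf.nonneg le_rfl
    (fun z => by simpa using hf.bound (x + s • z))
  simpa [shiftMean] using this

lemma empirical_mean_dev_sub_L2_vec {d : ℕ} {γ : Measure (Vec d)} [IsProbabilityMeasure γ] {σ : ℝ}
    (hσ : L2Bound γ (fun z => ‖z‖) σ) {N : ℕ} (hN : 1 ≤ N) {f : Vec d → Vec d} {L : ℝ}
    (hf : FourPoint f L) (x y : Vec d) (s s' : ℝ) :
    L2Bound (Measure.pi fun _ : Fin N => γ)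
      (fun z => ‖(shiftMean (empirical z) f x s - shiftMean γ f x s)
        - (shiftMean (empirical z) f y s' - shiftMean γ f y s')‖)
      (d * (L * (‖x - y‖ + |s - s'| * σ) * (√N)⁻¹)) := by
  have hL := hf.nonneg
  have := empirical_dev_L2_vec hσ hN (φ := fun z => f (x + s • z) - f (y + s' • z))
    (a := L * ‖x - y‖) (b := L * |s - s'|)
    ((hf.continuous.comp (by fun_prop)).sub (hf.continuous.comp (by fun_prop))).measurable
    (by positivity) (by positivity)
    (fun z => (hf.norm_shift_sub_le x y z s s').trans (by rw [mul_add, mul_assoc]))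
  refine (this.congr fun z => ?_).mono (le_of_eq (by ring))
  rw [integral_sub (μ := γ) (hf.integrable_shift x s) (hf.integrable_shift y s'),
    integral_sub (integrable_empirical hN z _) (integrable_empirical hN z _)]
  simp only [shiftMean]
  congr 1
  abel

/-! ### Verification of the abstract drift hypotheses. -/

lemma measurable_driftMC {d N : ℕ} {f : Vec d → ℝ} (hf : Continuous f)
    (hg : Continuous (gradient f)) (t : ℝ) :
    Measurable fun p : (Fin N → Vec d) × Vec d => driftMC f p.1 p.2 t := by
  have h1 := hf.measurable
  have h2 := hg.measurable
  unfold driftMC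
  fun_prop

/-- The Monte Carlo drift approximates the exact drift at rate `1 / √N`. -/
theorem exists_driftApprox {d : ℕ} {f : Vec d → ℝ} (hA : AssumptionA1 f) :
    ∃ Λ : ℝ, ∀ N : ℕ, 1 ≤ N →
      ∃ M : (Fin N → Vec d) → ℝ, DriftApprox (Measure.pi fun _ : Fin N => stdGaussian (Vec d))
        (drift f) (fun z => driftMC f z) M Λ (√N)⁻¹ := by
  obtain ⟨c, L, hc, hcf, hf, hg⟩ := hA.exists_fourPoint
  have hL := hf.nonneg
  have hmem : MemLp (fun z : Vec d => ‖z‖) 2 (stdGaussian (Vec d)) :=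
    (IsGaussian.memLp_two_id (μ := stdGaussian (Vec d))).norm
  have hint : Integrable (fun z : Vec d => ‖z‖) (stdGaussian (Vec d)) :=
    hmem.integrable (by norm_num)
  -- One constant dominates both the L² norm and the mean of `‖z‖`.
  obtain ⟨σ, hσ, hmσ⟩ : ∃ σ, L2Bound (stdGaussian (Vec d)) (fun z => ‖z‖) σ ∧
      ∫ z : Vec d, ‖z‖ ∂(stdGaussian (Vec d)) ≤ σ := by
    refine ⟨max (eLpNorm (fun z : Vec d => ‖z‖) 2 (stdGaussian (Vec d))).toReal
      (∫ z : Vec d, ‖z‖ ∂(stdGaussian (Vec d))), ⟨?_, hmem.aestronglyMeasurable, ?_⟩, le_max_right _ _⟩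
    · exact le_max_of_le_left ENNReal.toReal_nonneg
    · refine le_trans ?_ (ENNReal.ofReal_le_ofReal (le_max_left _ _))
      rw [ENNReal.ofReal_toReal hmem.2.ne]
  have hm0 : 0 ≤ ∫ z : Vec d, ‖z‖ ∂(stdGaussian (Vec d)) := integral_nonneg fun _ => norm_nonneg _
  -- Below, `κ` absorbs the dimensional factor of the vector estimates together with the factor 1 of
  -- the scalar ones.
  have hσ0 := hσ.nonneg
  set κ : ℝ := 1 + d
  have hκ1 : 1 ≤ κ := by simp [κ]
  have hκd : (d : ℝ) ≤ κ := by simp [κ]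
  set a := L / c with ha_def
  have ha : 0 ≤ a := by positivity
  set B := c⁻¹ * (L + L * a) with hB_def
  have hB : 0 ≤ B := by positivity
  set D := c⁻¹ * (L + L * a + 2 * L * B) with hD_def
  have hD : 0 ≤ D := by positivity
  set Q := c⁻¹ * ((1 + σ) * κ * (L + 3 * a * L + 2 * B * L)) with hQ_def
  have hQ : 0 ≤ Q := by positivity
  have hBσ : 0 ≤ B * σ := by positivity
  have hκB : 0 ≤ κ * B := by positivity
  -- The summands serve in turn: `a` for boundedness, `B` and `B * σ` for Lipschitz bounds in space
  -- and time, `D` for `second_diff`, `σ` for moments, `κ * B` for `dev`, `Q` for `dev_sub`. The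
  -- witness `M` is the fluctuation of the empirical mean of `‖z‖`.
  refine ⟨a + B + B * σ + D + σ + κ * B + Q, fun N hN =>
    ⟨fun z => |∫ x : Vec d, ‖x‖ ∂(empirical z) - ∫ x : Vec d, ‖x‖ ∂(stdGaussian (Vec d))|, ?_⟩⟩
  set Λ := a + B + B * σ + D + σ + κ * B + Q with hΛ_def
  have hΛ : 0 ≤ Λ := by positivity
  have hdr := drift_eq_ratioDrift hA.differentiable hc hcf hf hg
  have hε : 0 ≤ (√(N : ℝ))⁻¹ := by positivity
  refine
    { nonneg := hΛ
      eps_nonneg := hε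
      measurable := measurable_driftMC hf.continuous hg.continuous
      bound := ?_
      lip := ?_
      bound_approx := ?_
      lip_approx := ?_
      second_diff := ?_
      dev := ?_
      dev_sub := ?_
      moment_nonneg := fun z => by positivity
      moment := ?_ }
  · intro x t
    rw [hdr]
    exact (norm_ratioDrift_le hc hcf hf hg x t).trans (by linarith)
  · intro x y t t'
    rw [hdr, hdr]
    refine (norm_ratioDrift_sub_le hc hcf hf hg hint x y t t').trans ?_
    rw [← hB_def, mul_add B, mul_add Λ]
    refine add_le_add (mul_le_mul_of_nonneg_right (by linarith) (norm_nonneg _)) ?_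
    have h1 := mul_le_mul_of_nonneg_left hmσ (by positivity : 0 ≤ B * √|t - t'|)
    have h2 : B * σ * √|t - t'| ≤ Λ * √|t - t'| :=
      mul_le_mul_of_nonneg_right (by linarith) (Real.sqrt_nonneg _)
    linarith
  · intro z x t
    have := isProbabilityMeasure_empirical hN z
    rw [driftMC_eq_ratioDrift]
    exact (norm_ratioDrift_le hc hcf hf hg x t).trans (by linarith)
  · intro z x y t
    have := isProbabilityMeasure_empirical hN z
    rw [driftMC_eq_ratioDrift, driftMC_eq_ratioDrift]
    have h := norm_ratioDrift_sub_le hc hcf hf hg (integrable_empirical hN z _) x y t t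
    rw [sub_self, abs_zero, Real.sqrt_zero, zero_mul, add_zero] at h
    exact h.trans (mul_le_mul_of_nonneg_right (by linarith) (norm_nonneg _))
  · intro z x₁ x₂ x₃ x₄ t t'
    have := isProbabilityMeasure_empirical hN z
    simp only [driftMC_eq_ratioDrift]
    refine (norm_ratioDrift_four_point_le hc hcf hf hg (integrable_empirical hN z _)
      x₁ x₂ x₃ x₄ t t').trans ?_
    have h1 : ∫ x : Vec d, ‖x‖ ∂(empirical z) ≤
        Λ + |∫ x : Vec d, ‖x‖ ∂(empirical z) - ∫ x : Vec d, ‖x‖ ∂(stdGaussian (Vec d))| := by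
      linarith [le_abs_self (∫ x : Vec d, ‖x‖ ∂(empirical z) - ∫ x : Vec d, ‖x‖ ∂(stdGaussian (Vec d)))]
    have h2 : 0 ≤ ∫ x : Vec d, ‖x‖ ∂(empirical z) := integral_nonneg fun _ => norm_nonneg _
    refine mul_le_mul (by linarith) ?_ (by positivity) hΛ
    gcongr
  · intro x t
    have hF := empirical_mean_dev_L2 hσ hN hf x √(1 - t)
    have hG := empirical_mean_dev_L2_vec hσ hN hg x √(1 - t)
    have h := (hG.add (hF.const_mul ha)).const_mul (inv_nonneg.2 hc.le)
    have hm : AEStronglyMeasurable (fun z : Fin N → Vec d => ‖driftMC f z x t - drift f x t‖)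
        (Measure.pi fun _ : Fin N => stdGaussian (Vec d)) :=
      ((((measurable_driftMC hf.continuous hg.continuous t).comp
        (measurable_id.prodMk measurable_const)).sub_const _).norm).aestronglyMeasurable
    refine (h.mono_fun hm fun z => ?_).mono ?_
    · have := isProbabilityMeasure_empirical hN z
      rw [abs_norm, hdr, driftMC_eq_ratioDrift]
      refine (norm_ratio_sub_le hc (le_shiftMean hf hcf x _) (le_shiftMean hf hcf x _)
        (norm_shiftMean_le hg x _)).trans (le_of_eq ?_)
      ring
    · have h1 : c⁻¹ * (d * (L * (√(N : ℝ))⁻¹) + a * (L * (√(N : ℝ))⁻¹)) ≤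
          κ * B * (√(N : ℝ))⁻¹ := by
        rw [show κ * B * (√(N : ℝ))⁻¹
          = c⁻¹ * (κ * (L * (√(N : ℝ))⁻¹) + κ * (a * (L * (√(N : ℝ))⁻¹))) by rw [hB_def]; ring]
        refine mul_le_mul_of_nonneg_left (add_le_add ?_ ?_) (by positivity)
        · exact mul_le_mul_of_nonneg_right hκd (by positivity)
        · exact le_mul_of_one_le_left (by positivity) hκ1
      exact h1.trans (mul_le_mul_of_nonneg_right (by linarith) hε)
  · intro x y t t'
    have hs := abs_sqrt_one_sub_sub_le t t'
    have hs0 := Real.sqrt_nonneg |t - t'|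
    set τ := ‖x - y‖ + √|t - t'| with hτ_def
    have hτ0 : 0 ≤ τ := by positivity
    -- Used with `m = σ` for the Monte Carlo errors and with `m` the Gaussian mean of `‖z‖` for the
    -- exact averages.
    have hτ : ∀ m ≤ σ, 0 ≤ m → ‖x - y‖ + |√(1 - t) - √(1 - t')| * m ≤ (1 + σ) * τ := by
      intro m hm hm0
      have h1 := mul_le_mul hs hm hm0 hs0
      nlinarith [mul_nonneg hσ0 (norm_nonneg (x - y))]
    have hF := (empirical_mean_dev_sub_L2 hσ hN hf x y √(1 - t) √(1 - t')).mono
      (K' := L * ((1 + σ) * τ) * (√(N : ℝ))⁻¹) (by gcongr; exact hτ σ le_rfl hσ0)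
    have hG := (empirical_mean_dev_sub_L2_vec hσ hN hg x y √(1 - t) √(1 - t')).mono
      (K' := κ * (L * ((1 + σ) * τ) * (√(N : ℝ))⁻¹)) (by gcongr; exact hτ σ le_rfl hσ0)
    have hF' := empirical_mean_dev_L2 hσ hN hf y √(1 - t')
    have hG' := (empirical_mean_dev_L2_vec hσ hN hg y √(1 - t')).mono
      (K' := κ * (L * (√(N : ℝ))⁻¹)) (by gcongr)
    have hρ : 0 ≤ (1 + σ) * τ := by positivity
    have h := ((((hG.add (hF.const_mul (by positivity : 0 ≤ 3 * a))).add
      (hF'.const_mul (by positivity : 0 ≤ B * ((1 + σ) * τ)))).add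
      (((hG'.add (hF'.const_mul ha)).const_mul (inv_nonneg.2 hc.le)).const_mul
        (by positivity : 0 ≤ L * ((1 + σ) * τ))))).const_mul (inv_nonneg.2 hc.le)
    have hm : AEStronglyMeasurable (fun z : Fin N → Vec d =>
        ‖(driftMC f z x t - drift f x t) - (driftMC f z y t' - drift f y t')‖)
        (Measure.pi fun _ : Fin N => stdGaussian (Vec d)) :=
      ((((measurable_driftMC hf.continuous hg.continuous t).comp
        (measurable_id.prodMk measurable_const)).sub_const _).sub
        (((measurable_driftMC hf.continuous hg.continuous t').comp
        (measurable_id.prodMk measurable_const)).sub_const _)).norm.aestronglyMeasurable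
    refine (h.mono_fun hm fun z => ?_).mono ?_
    · have := isProbabilityMeasure_empirical hN z
      rw [abs_norm, hdr, hdr, driftMC_eq_ratioDrift, driftMC_eq_ratioDrift]
      have hmean := hτ _ hmσ hm0
      refine (norm_ratio_dev_sub_le hc hL hρ (le_shiftMean hf hcf x _) (le_shiftMean hf hcf y _)
        (le_shiftMean hf hcf x _) (le_shiftMean hf hcf y _) (norm_shiftMean_le hg x _)
        (norm_shiftMean_le hg y _) (norm_shiftMean_le hg y _)
        ((norm_shiftMean_sub_le hf hint _ _ _ _).trans (mul_le_mul_of_nonneg_left hmean hL))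
        ((norm_shiftMean_sub_le hg hint _ _ _ _).trans
          (mul_le_mul_of_nonneg_left hmean hL))).trans (le_of_eq ?_)
      rw [mul_comm a]
    · have hQτ : Q * (√(N : ℝ))⁻¹ * τ ≤ Λ * (√(N : ℝ))⁻¹ * τ :=
        mul_le_mul_of_nonneg_right (mul_le_mul_of_nonneg_right (by linarith) hε) hτ0
      refine le_trans ?_ hQτ
      rw [show Q * (√(N : ℝ))⁻¹ * τ = c⁻¹ * ((1 + σ) * κ * (L + 3 * a * L + 2 * B * L)
        * (√(N : ℝ))⁻¹ * τ) by rw [hQ_def]; ring]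
      refine mul_le_mul_of_nonneg_left ?_ (inv_nonneg.2 hc.le)
      have e1 : c⁻¹ * (κ * (L * (√(N : ℝ))⁻¹) + a * (L * (√(N : ℝ))⁻¹)) ≤
          κ * B * (√(N : ℝ))⁻¹ := by
        rw [show κ * B * (√(N : ℝ))⁻¹
          = c⁻¹ * (κ * (L * (√(N : ℝ))⁻¹) + κ * (a * (L * (√(N : ℝ))⁻¹))) by rw [hB_def]; ring]
        refine mul_le_mul_of_nonneg_left (add_le_add_right ?_ _) (by positivity)
        exact le_mul_of_one_le_left (by positivity) hκ1
      have e2 := mul_le_mul_of_nonneg_left e1 (by positivity : 0 ≤ L * ((1 + σ) * τ))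
      have e3 := mul_le_mul_of_nonneg_right hκ1
        (by positivity : 0 ≤ (3 * a * L + B * L) * ((1 + σ) * τ) * (√(N : ℝ))⁻¹)
      linarith
  · have h := empirical_dev_L2 hσ hN (φ := fun z => ‖z‖) measurable_norm le_rfl zero_le_one
      (fun z => by simp)
    refine h.mono ?_
    rw [zero_add, one_mul]
    exact mul_le_mul_of_nonneg_right (by linarith) hε

/-! ### Integration over the Brownian path. -/

/-- The path `w` stopped outside `[0, 1]`. -/
def clampPath {d : ℕ} (g : unitInterval → Vec d) (t : ℝ) : Vec d :=
  g (Set.projIcc 0 1 zero_le_one t)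

lemma measurable_clampPath {d : ℕ} : Measurable (clampPath (d := d)) :=
  measurable_pi_lambda _ fun _ => measurable_pi_apply _

lemma clampPath_of_mem {d : ℕ} (w : ℝ → Vec d) {t : ℝ} (ht : t ∈ Set.Icc (0 : ℝ) 1) :
    clampPath (fun t : unitInterval => w t) t = w t := by
  simp [clampPath, Set.projIcc_of_mem zero_le_one ht]

lemma grid_mem {l k : ℕ} (hk : k ≤ 2 ^ l) : (k : ℝ) * stepSize l ∈ Set.Icc (0 : ℝ) 1 :=
  ⟨mul_nonneg (Nat.cast_nonneg k) (stepSize_pos l).le, natCast_mul_stepSize_le_one hk⟩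

/-- Measurability and independence of `W` are assumed only on `[0, 1]`, which contains the grid;
clamping yields a path on all of `ℝ` that is a measurable function of those values. -/
lemma euler_clampPath {d : ℕ} (β : Vec d → ℝ → Vec d) (w : ℝ → Vec d) (l : ℕ) :
    ∀ k ≤ 2 ^ l, euler β (clampPath fun t : unitInterval => w t) l k = euler β w l k := by
  intro k
  induction k with
  | zero => intro _; rfl
  | succ k ih =>
    intro hk
    rw [euler_succ, euler_succ, ih (by omega), increment, increment,
      clampPath_of_mem w (grid_mem hk), clampPath_of_mem w (grid_mem (by omega : k ≤ 2 ^ l))]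

lemma measurable_euler_path {d : ℕ} {α : Type*} [MeasurableSpace α] {β : α → Vec d → ℝ → Vec d}
    (hβ : ∀ t, Measurable fun p : α × Vec d => β p.1 p.2 t) (l k : ℕ) :
    Measurable fun p : (ℝ → Vec d) × α => euler (β p.2) p.1 l k := by
  induction k with
  | zero => exact measurable_const
  | succ k ih =>
    simp only [euler_succ, increment]
    have h1 := (hβ (k * stepSize l)).comp (measurable_snd.prodMk ih)
    have h2 : ∀ t : ℝ, Measurable fun p : (ℝ → Vec d) × α => p.1 t := fun t =>
      (measurable_pi_apply t).comp measurable_fst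
    exact (ih.add (h1.const_smul (stepSize l))).add ((h2 _).sub (h2 _))

lemma DriftApprox.measurable_coupledError {d : ℕ} {α : Type*} [MeasurableSpace α]
    {π : Measure α} {b : Vec d → ℝ → Vec d} {bN : α → Vec d → ℝ → Vec d} {M : α → ℝ} {Λ ε : ℝ}
    (H : DriftApprox π b bN M Λ ε) (m k : ℕ) :
    Measurable fun p : (ℝ → Vec d) × α => DriftApprox.coupledError b bN p.1 m k p.2 := by
  have hb : ∀ t, Measurable fun p : α × Vec d => b p.2 t := by
    intro t
    have hc : Continuous fun x => b x t := by
      refine (LipschitzWith.of_dist_le_mul (K := ⟨Λ, H.nonneg⟩) fun x y => ?_).continuous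
      rw [dist_eq_norm, dist_eq_norm]
      refine (H.lip x y t t).trans_eq ?_
      rw [sub_self, abs_zero, Real.sqrt_zero, add_zero]
      rfl
    exact hc.measurable.comp measurable_snd
  have h1 := measurable_euler_path H.measurable
  have h2 := measurable_euler_path (β := fun _ : α => b) hb
  exact ((h1 _ _).sub (h1 _ _)).sub ((h2 _ _).sub (h2 _ _))

lemma IsBrownianMotion.increment_L2 {d : ℕ} {Ω : Type*} [MeasurableSpace Ω] {P : Measure Ω}
    {W : ℝ → Ω → Vec d} (hW : IsBrownianMotion W P) {σ : ℝ}
    (hσ : L2Bound (stdGaussian (Vec d)) (fun z => ‖z‖) σ) {s t : ℝ} (hs : 0 ≤ s) (hst : s ≤ t)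
    (ht : t ≤ 1) : L2Bound P (fun ω => ‖W t ω - W s ω‖) (√(t - s) * σ) where
  nonneg := mul_nonneg (Real.sqrt_nonneg _) hσ.nonneg
  aesm := (hW.law_increments s t hs hst ht).aemeasurable.norm.aestronglyMeasurable
  eLpNorm_le := by
    have hl := hW.law_increments s t hs hst ht
    have h1 : eLpNorm (fun ω => ‖W t ω - W s ω‖) 2 P
        = eLpNorm (fun z : Vec d => ‖z‖) 2 (P.map (W t - W s)) := by
      rw [eLpNorm_map_measure continuous_norm.aestronglyMeasurable hl.aemeasurable]
      rfl
    rw [h1, hl.map_eq, eLpNorm_map_measure continuous_norm.aestronglyMeasurable (by fun_prop)]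
    refine ((hσ.const_mul (Real.sqrt_nonneg (t - s))).congr fun z => ?_).eLpNorm_le
    simp [norm_smul, abs_of_nonneg (Real.sqrt_nonneg (t - s))]

/-- Each increment has L² norm at most `√(stepSize l) * σ`, and the weights sum to one. -/
lemma IsBrownianMotion.meanIncrement_L2 {d : ℕ} {Ω : Type*} [MeasurableSpace Ω] {P : Measure Ω}
    {W : ℝ → Ω → Vec d} (hW : IsBrownianMotion W P) {σ : ℝ}
    (hσ : L2Bound (stdGaussian (Vec d)) (fun z => ‖z‖) σ) (l : ℕ) :
    L2Bound P (fun ω => meanIncrement (clampPath fun t : unitInterval => W t ω) l)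
      (√(stepSize l) * σ) := by
  have h : ∀ j ∈ Finset.range (2 ^ l), L2Bound P
      (fun ω => stepSize l * ‖increment (clampPath fun t : unitInterval => W t ω) l j‖)
      (stepSize l * (√(stepSize l) * σ)) := by
    intro j hj
    have hj' : j + 1 ≤ 2 ^ l := Finset.mem_range.1 hj
    have h0 := grid_mem (l := l) (show j ≤ 2 ^ l by omega)
    have h1 := grid_mem hj'
    have e : ((j + 1 : ℕ) : ℝ) * stepSize l - j * stepSize l = stepSize l := by push_cast; ring
    have := hW.increment_L2 hσ h0.1 (by linarith [stepSize_pos l]) h1.2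
    rw [e] at this
    refine (this.congr fun ω => ?_).const_mul (stepSize_pos l).le
    rw [increment, clampPath_of_mem (fun t => W t ω) h0, clampPath_of_mem (fun t => W t ω) h1]
  refine (L2Bound.sum _ h).mono (le_of_eq ?_)
  rw [Finset.sum_const, Finset.card_range, nsmul_eq_mul, ← mul_assoc]
  push_cast
  rw [two_pow_mul_stepSize, one_mul]

/-- The product form of the joint law allows the path to be frozen while the sample is integrated.
-/
lemma IsRandomInput.map_eq_prod {d N : ℕ} {Ω : Type*} [MeasurableSpace Ω] {P : Measure Ω}
    [IsProbabilityMeasure P] {W : ℝ → Ω → Vec d} {Z : Fin N → Ω → Vec d}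
    (h : IsRandomInput W Z P) :
    P.map (fun ω => ((clampPath fun t : unitInterval => W t ω), fun i => Z i ω))
      = (P.map fun ω => clampPath fun t : unitInterval => W t ω).prod
        (Measure.pi fun _ : Fin N => stdGaussian (Vec d)) := by
  have hW : Measurable fun ω => fun t : unitInterval => W t ω :=
    measurable_pi_lambda _ fun t => h.brownian.measurable t t.2
  have hZ : Measurable fun ω => fun i => Z i ω := measurable_pi_lambda _ h.measurable_Z
  have hind := h.indep_W_Z.comp (measurable_clampPath (d := d)) measurable_id
  have h1 := (indepFun_iff_map_prod_eq_prod_map_map (measurable_clampPath.comp hW).aemeasurable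
    hZ.aemeasurable).1 hind
  have h2 := (iIndepFun_iff_map_fun_eq_pi_map fun i => (h.measurable_Z i).aemeasurable).1 h.indep_Z
  simp only [fun i => (h.law_Z i).map_eq] at h2
  rw [← h2]
  exact h1

lemma IsRandomInput.coupledError_L2 {d N : ℕ} {Ω : Type*} [MeasurableSpace Ω] {P : Measure Ω}
    [IsProbabilityMeasure P] {W : ℝ → Ω → Vec d} {Z : Fin N → Ω → Vec d}
    (h : IsRandomInput W Z P) {b : Vec d → ℝ → Vec d} {bN : (Fin N → Vec d) → Vec d → ℝ → Vec d}
    {M : (Fin N → Vec d) → ℝ} {Λ ε σ : ℝ}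
    (H : DriftApprox (Measure.pi fun _ : Fin N => stdGaussian (Vec d)) b bN M Λ ε)
    (hσ : L2Bound (stdGaussian (Vec d)) (fun z => ‖z‖) σ) (m : ℕ) :
    L2Bound P (fun ω => ‖DriftApprox.coupledError b bN
        (clampPath fun t : unitInterval => W t ω) m (2 ^ m) fun i => Z i ω‖)
      (DriftApprox.coupledConst Λ * ε * (√(stepSize (m + 1)) + √(stepSize (m + 1)) * σ)) := by
  have hΛ := H.nonneg
  have hε := H.eps_nonneg
  have hW : Measurable fun ω => clampPath fun t : unitInterval => W t ω :=
    measurable_clampPath.comp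
      (measurable_pi_lambda _ fun t : unitInterval => h.brownian.measurable t t.2)
  have hZ : Measurable fun ω => fun i => Z i ω := measurable_pi_lambda _ h.measurable_Z
  have hu := (H.measurable_coupledError m (2 ^ m)).norm
  have hC : 0 ≤ DriftApprox.coupledConst Λ * ε :=
    mul_nonneg (by unfold DriftApprox.coupledConst; positivity) hε
  have hbound := ((L2Bound.const (μ := P) (Real.sqrt_nonneg (stepSize (m + 1)))).add
    (h.brownian.meanIncrement_L2 hσ (m + 1))).const_mul hC
  have hV : Measurable fun w : ℝ → Vec d => meanIncrement w (m + 1) := by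
    unfold meanIncrement increment
    fun_prop
  refine L2Bound.of_lintegral_sq_le hbound.nonneg
    (hu.comp (hW.prodMk hZ)).aestronglyMeasurable (le_trans ?_ hbound.lintegral_sq_le)
  have e1 : ∫⁻ ω, ENNReal.ofReal (‖DriftApprox.coupledError b bN
        (clampPath fun t : unitInterval => W t ω) m (2 ^ m) fun i => Z i ω‖ ^ 2) ∂P
      = ∫⁻ p, ENNReal.ofReal (‖DriftApprox.coupledError b bN p.1 m (2 ^ m) p.2‖ ^ 2)
        ∂(P.map fun ω => ((clampPath fun t : unitInterval => W t ω), fun i => Z i ω)) := by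
    rw [lintegral_map (hu.pow_const 2).ennreal_ofReal (hW.prodMk hZ)]
  have e2 : ∫⁻ ω, ENNReal.ofReal ((DriftApprox.coupledConst Λ * ε * (√(stepSize (m + 1))
        + meanIncrement (clampPath fun t : unitInterval => W t ω) (m + 1))) ^ 2) ∂P
      = ∫⁻ w, ENNReal.ofReal ((DriftApprox.coupledConst Λ * ε * (√(stepSize (m + 1))
        + meanIncrement w (m + 1))) ^ 2)
        ∂(P.map fun ω => clampPath fun t : unitInterval => W t ω) := by
    rw [lintegral_map (((hV.const_add _).const_mul _).pow_const 2).ennreal_ofReal hW]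
  -- Tonelli: for each `w` the inner integral over the sample is bounded by the fixed-path estimate.
  rw [e1, e2, h.map_eq_prod, lintegral_prod _ (hu.pow_const 2).ennreal_ofReal.aemeasurable]
  exact lintegral_mono fun w => (H.coupledError_L2 w m).lintegral_sq_le

end SchrodingerFollmer

end

/-! ### The main estimate. -/

theorem theorem1 (d : ℕ) (f : SchrodingerFollmer.Vec d → ℝ)
    (hf : SchrodingerFollmer.AssumptionA1 f) :
    ∃ C : ℝ, ∀ (l N : ℕ), 1 ≤ l → 1 ≤ N →
      ∀ (Ω : Type*) [MeasurableSpace Ω] (P : Measure Ω) [IsProbabilityMeasure P]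
        (W : ℝ → Ω → SchrodingerFollmer.Vec d) (Z : Fin N → Ω → SchrodingerFollmer.Vec d),
        SchrodingerFollmer.IsRandomInput W Z P →
        Integrable (fun ω =>
          ‖(SchrodingerFollmer.XMC f W Z l ω - SchrodingerFollmer.XMC f W Z (l - 1) ω)
            - (SchrodingerFollmer.XExact f W l ω - SchrodingerFollmer.XExact f W (l - 1) ω)‖ ^ 2)
          P ∧
        ∫ ω, ‖(SchrodingerFollmer.XMC f W Z l ω - SchrodingerFollmer.XMC f W Z (l - 1) ω)
            - (SchrodingerFollmer.XExact f W l ω - SchrodingerFollmer.XExact f W (l - 1) ω)‖ ^ 2 ∂P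
          ≤ C * SchrodingerFollmer.stepSize l / N := by
  open SchrodingerFollmer in
  obtain ⟨Λ, hΛ⟩ := exists_driftApprox hf
  have hmem : MemLp (fun z : Vec d => ‖z‖) 2 (stdGaussian (Vec d)) :=
    (IsGaussian.memLp_two_id (μ := stdGaussian (Vec d))).norm
  obtain ⟨σ, hσ⟩ : ∃ σ, L2Bound (stdGaussian (Vec d)) (fun z => ‖z‖) σ :=
    ⟨_, ENNReal.toReal_nonneg, hmem.aestronglyMeasurable,
      (ENNReal.ofReal_toReal hmem.2.ne).ge⟩
  -- The constant depends only on `Λ` and `σ`, both chosen before `l` and `N`; `1 + σ` collects `√h`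
  -- and the mean increment.
  refine ⟨(DriftApprox.coupledConst Λ * (1 + σ)) ^ 2, fun l N hl hN Ω _ P _ W Z hWZ => ?_⟩
  obtain ⟨m, rfl⟩ : ∃ m, l = m + 1 := ⟨l - 1, by omega⟩
  obtain ⟨M, H⟩ := hΛ N hN
  have key := hWZ.coupledError_L2 H hσ m
  have e : ∀ ω, (XMC f W Z (m + 1) ω - XMC f W Z (m + 1 - 1) ω)
      - (XExact f W (m + 1) ω - XExact f W (m + 1 - 1) ω)
      = DriftApprox.coupledError (drift f) (fun z => driftMC f z)
        (clampPath fun t : unitInterval => W t ω) m (2 ^ m) fun i => Z i ω := by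
    intro ω
    have h2 : 2 * 2 ^ m = 2 ^ (m + 1) := by rw [pow_succ, mul_comm]
    simp only [XMC, XExact, eulerOne, DriftApprox.coupledError, Nat.add_sub_cancel]
    rw [h2, euler_clampPath _ (fun t => W t ω) _ _ le_rfl,
      euler_clampPath _ (fun t => W t ω) _ _ le_rfl,
      euler_clampPath _ (fun t => W t ω) _ _ le_rfl,
      euler_clampPath _ (fun t => W t ω) _ _ le_rfl]
  simp only [e]
  refine ⟨key.memLp.integrable_sq, key.integral_sq_le.trans (le_of_eq ?_)⟩
  have h1 := Real.sq_sqrt (stepSize_pos (m + 1)).le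
  have h2 := Real.sq_sqrt (Nat.cast_nonneg (α := ℝ) N)
  rw [show DriftApprox.coupledConst Λ * (√(N : ℝ))⁻¹
      * (√(stepSize (m + 1)) + √(stepSize (m + 1)) * σ)
    = DriftApprox.coupledConst Λ * (1 + σ) * √(stepSize (m + 1)) * (√(N : ℝ))⁻¹ by ring,
    mul_pow, mul_pow _ √(stepSize (m + 1)), inv_pow, h1, h2, div_eq_mul_inv]
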